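/- Let $1\le m<n$, and let $N$ be a compact connected (Hausdorff) $n$-dimensional $C^\infty$ manifold with boundary. Let $F\colon N\to\mathbb{R}^m$ be a boundary special generic map, that is, a $C^\infty$ map such that * $F$ is a submersion: $dF_p\colon T_pN\to\mathbb{R}^m$ is surjective for every $p\in N$ (boundary points included); and * every singular point $p$ of $F|_{\partial N}$ (a point $p\in\partial N$ at which $dF_p|_{T_p\partial N}$ is not surjective onto $\mathbb{R}^m$) is a boundary definite fold point of $F$: there are smooth local coordinates $(x_1,\dots,x_n)$ of $N$ centred at $p$, in which $x_n>0$ and $x_n=0$ correspond to $\operatorname{Int}N$ and $\partial N$ respectively, and smooth local coordinates $(y_1,\dots,y_m)$ of $\mathbb{R}^m$ around $F(p)$, in which $F$ has the form $$(x_1,\dots,x_n)\mapsto\Bigl(x_1,\dots,x_{m-1},\ \sum_{i=m}^{n-1}x_i^2+x_n\Bigr).$$ Let $W_F=N/{\sim}$ be the Reeb space of $F$ with the quotient topology, where $x\sim y$ if and only if $F(x)=F(y)$ and $x$ and $y$ lie in the same connected component of $F^{-1}(F(x))$. Then $$\pi_1(N)\cong\pi_1(W_F),$$ that is, for all base points $x\in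 N$ and $w\in W_F$ the groups $\pi_1(N,x)$ and $\pi_1(W_F,w)$ are isomorphic. -/

import Mathlib

open scoped Manifold ContDiff

noncomputable section

namespace BoundarySpecialGeneric

/-- The normal form `(x_1, …, x_n) ↦ (x_1, …, x_{m-1}, x_m ^ 2 + ⋯ + x_{n-1} ^ 2 + x_n)`.
The coordinate `x_i` with `1 ≤ i ≤ n - 1` is the entry of index `i`, and `x_n`, the coordinate that
is nonnegative on the half-space, is the entry of index `0`, as in Mathlib's `EuclideanHalfSpace`.
The coordinate `y_j` of the target is the entry of index `j - 1`. -/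
def foldForm {n m : ℕ} [NeZero n] (hmn : m < n) (x : EuclideanSpace ℝ (Fin n)) :
    EuclideanSpace ℝ (Fin m) :=
  WithLp.toLp 2 fun j : Fin m =>
    if (j : ℕ) + 1 < m then x ⟨(j : ℕ) + 1, by omega⟩
    else (∑ i ∈ {i : Fin n | m ≤ (i : ℕ)}, x i ^ 2) + x 0

variable {n m : ℕ} [NeZero n]
  {N : Type*} [TopologicalSpace N] [ChartedSpace (EuclideanHalfSpace n) N]
  {L : Type*} [TopologicalSpace L] [ChartedSpace (EuclideanSpace ℝ (Fin m)) L]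

/-- `p` is a boundary definite fold point of `F`: in smooth coordinates centred at `p` and around
`F p`, the map `F` is the normal form `foldForm`. -/
def IsBoundaryDefiniteFoldPoint (hmn : m < n) (F : N → L) (p : N) : Prop :=
  p ∈ (𝓡∂ n).boundary N ∧
  ∃ φ ∈ IsManifold.maximalAtlas (𝓡∂ n) ∞ N, ∃ ψ ∈ IsManifold.maximalAtlas (𝓡 m) ∞ L,
    p ∈ φ.source ∧ (φ p).val = 0 ∧
    ∀ x ∈ φ.source, F x ∈ ψ.source ∧ ψ (F x) = foldForm hmn (φ x).val

/-- The tangent space of the boundary at a boundary point `p`, as a subspace of the tangent space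
of `N` at `p`. Mathlib identifies the latter with `ℝⁿ` through the preferred half-space chart at `p`,
in which the boundary is the hyperplane where the coordinate of index `0` vanishes. -/
def boundaryTangentSpace (p : N) : Submodule ℝ (TangentSpace (𝓡∂ n) p) :=
  LinearMap.ker (EuclideanSpace.proj 0 : EuclideanSpace ℝ (Fin n) →L[ℝ] ℝ).toLinearMap

/-- The singular points of the restriction of `F` to the boundary of `N`: the boundary points at
which the differential of `F` is not surjective on the tangent space of the boundary. -/
def boundarySingularSet (F : N → L) : Set N :=
  {p | p ∈ (𝓡∂ n).boundary N ∧
    (boundaryTangentSpace p).map (mfderiv (𝓡∂ n) (𝓡 m) F p).toLinearMap ≠ ⊤}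

/-- `F` is a boundary special generic map: a smooth submersion such that all the singular points of
its restriction to the boundary are boundary definite fold points. -/
structure IsBoundarySpecialGenericMap (hmn : m < n) (F : N → L) : Prop where
  contMDiff : ContMDiff (𝓡∂ n) (𝓡 m) ∞ F
  surjective_mfderiv : ∀ p : N, Function.Surjective (mfderiv (𝓡∂ n) (𝓡 m) F p)
  fold : ∀ p ∈ boundarySingularSet (n := n) (m := m) F, IsBoundaryDefiniteFoldPoint hmn F p

end BoundarySpecialGeneric

/-- Two points are equivalent if they have the same image and lie in the same connected component of
the fibre of `F` through them. -/
def reebSetoid {X Y : Type*} [TopologicalSpace X] (F : X → Y) : Setoid X where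
  r x y := F x = F y ∧ y ∈ connectedComponentIn (F ⁻¹' {F x}) x
  iseqv :=
    { refl := fun x => ⟨rfl, mem_connectedComponentIn rfl⟩
      symm := by
        rintro x y ⟨h, hy⟩
        refine ⟨h.symm, ?_⟩
        rw [← h, ← connectedComponentIn_eq hy]
        exact mem_connectedComponentIn rfl
      trans := by
        rintro x y z ⟨h, hy⟩ ⟨h', hz⟩
        refine ⟨h.trans h', ?_⟩
        rw [connectedComponentIn_eq hy, h]
        exact hz }

/-- The Reeb space of `F`, with the quotient topology. -/
abbrev ReebSpace {X Y : Type*} [TopologicalSpace X] (F : X → Y) : Type _ :=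
  Quotient (reebSetoid F)

end

/-! The quotient map `q : N → W_F` has connected fibres, but that alone says little about
fundamental groups. The point is that `q` behaves locally like a projection whose fibres carry no
loops that are essential in `N`.

At an interior point, or at a regular point of the restriction of `F` to the boundary, `F` is
locally a projection, so points can be moved continuously to all nearby fibres (`HasLift`). By
compactness these local motions glue along a whole fibre component (`hasLift_of_isCompact`). At a
fold point the image is locally a half-space and the point is an entire fibre component; the normal
form gives an explicit motion to the fibres over that half-space (`IsIsolatedTubePoint`). Either way
a fibre component has arbitrarily small saturated neighbourhoods on which every fibre can be pushed
to every other one (`exists_isSaturatedTube`). These give local sections of `q` and a basis of open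
sets of `W_F` with path-connected preimages.

Within such a neighbourhood a loop is freely homotopic to a loop in any chosen fibre. Hence the
property that all loops in a fibre of `q` die in `N` is locally constant on the connected space
`W_F`. It holds at a fold point, where the fibre is a single point, and a fold point exists:
otherwise `F` would have open and compact image in `ℝᵐ` (`exists_isIsolatedTubePoint`). So it holds
everywhere.

It remains to compare fundamental groups (`nonempty_fundamentalGroup_mulEquiv`). Local sections and
path-connected fibres lift loops up to homotopy, giving surjectivity. For injectivity, homotopy
classes of paths in `N` starting at `x` form a covering of `W_F`, since inessential loops make them
insensitive to motion inside a fibre; homotopic paths have lifts with the same endpoint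
(`injective_of_goodSets`). -/

namespace LocallyInessential

open Set Filter Topology unitInterval

open Path

/-! ### Homotopy classes of paths and inessential loops. -/

section Loops

variable {X : Type*} [TopologicalSpace X]

/-- Every loop contained in `A` is null-homotopic in the ambient space. -/
def LoopsNullhomotopic (A : Set X) : Prop :=
  ∀ ⦃a : X⦄ (γ : Path a a), (∀ t, γ t ∈ A) → γ.Homotopic (Path.refl a)

theorem LoopsNullhomotopic.mono {A B : Set X} (hB : LoopsNullhomotopic B) (hAB : A ⊆ B) :
    LoopsNullhomotopic A :=
  fun _ γ hγ => hB γ fun t => hAB (hγ t)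

theorem trans_mem {A : Set X} {a b c : X} {γ : Path a b} {δ : Path b c}
    (hγ : ∀ t, γ t ∈ A) (hδ : ∀ t, δ t ∈ A) (t : I) : (γ.trans δ) t ∈ A := by
  have h : range (γ.trans δ) ⊆ A := by
    rw [Path.trans_range]
    exact union_subset (range_subset_iff.2 hγ) (range_subset_iff.2 hδ)
  exact h (mem_range_self t)

theorem LoopsNullhomotopic.mk_eq {A : Set X} (hA : LoopsNullhomotopic A) {a b : X}
    (γ δ : Path a b) (hγ : ∀ t, γ t ∈ A) (hδ : ∀ t, δ t ∈ A) :
    Homotopic.Quotient.mk γ = Homotopic.Quotient.mk δ := by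
  have h : Homotopic.Quotient.mk (γ.trans δ.symm) = Homotopic.Quotient.refl a :=
    Homotopic.Quotient.eq.2 (hA (γ.trans δ.symm) (trans_mem hγ fun t => hδ _))
  rw [Homotopic.Quotient.mk_trans, Homotopic.Quotient.mk_symm] at h
  calc Homotopic.Quotient.mk γ
      = ((Homotopic.Quotient.mk γ).trans (Homotopic.Quotient.mk δ).symm).trans
          (Homotopic.Quotient.mk δ) := by simp
    _ = Homotopic.Quotient.mk δ := by rw [h]; simp

theorem trans_trans_symm_trans {a b c d : X} (p : Homotopic.Quotient a b)
    (p' : Homotopic.Quotient d b) (r : Homotopic.Quotient b c) :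
    (p.trans r).trans (p'.trans r).symm = p.trans p'.symm := by
  have : (p'.trans r).symm = r.symm.trans p'.symm := by
    induction p' using Homotopic.Quotient.ind
    induction r using Homotopic.Quotient.ind
    simp only [← Homotopic.Quotient.mk_trans, ← Homotopic.Quotient.mk_symm, Path.trans_symm]
  rw [this, Homotopic.Quotient.trans_assoc, ← Homotopic.Quotient.trans_assoc r]
  simp

/-- A loop that is freely homotopic to a null-homotopic loop is null-homotopic. -/
theorem homotopic_refl_of_free_homotopy (H : C(I × I, X)) {a b : X} (γ : Path a a) (δ : Path b b)
    (hγ : ∀ t, H (0, t) = γ t) (hδ : ∀ t, H (1, t) = δ t) (hH : ∀ s, H (s, 0) = H (s, 1))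
    (h : δ.Homotopic (Path.refl b)) : γ.Homotopic (Path.refl a) := by
  let K : ContinuousMap.Homotopy (γ : C(I, X)) (δ : C(I, X)) :=
    { toContinuousMap := H
      map_zero_left := hγ
      map_one_left := hδ }
  let ε : Path a b := (K.evalAt 0).cast γ.source.symm δ.source.symm
  have hε : (K.evalAt 1).cast γ.target.symm δ.target.symm = ε := by
    ext s
    exact (hH s).symm
  have key := Path.Homotopic.map_trans_evalAt K Path.id
  have key' : (γ.trans ((K.evalAt 1).cast γ.target.symm δ.target.symm)).Homotopic (ε.trans δ) := by
    refine Eq.mp ?_ (key.pathCast γ.source.symm δ.target.symm)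
    congr 1
  rw [hε, ← Homotopic.Quotient.eq, Homotopic.Quotient.mk_trans, Homotopic.Quotient.mk_trans,
    Homotopic.Quotient.eq.2 h] at key'
  have h2 : Homotopic.Quotient.mk γ =
      ((Homotopic.Quotient.mk γ).trans (Homotopic.Quotient.mk ε)).trans
        (Homotopic.Quotient.mk ε).symm := by
    simp
  rw [← Homotopic.Quotient.eq, h2, key']
  simp

end Loops

/-! ### Fundamental groups under maps with locally inessential preimages. -/

section Covering

variable {X W : Type*} [TopologicalSpace X] [TopologicalSpace W]

/-- An open set with path-connected preimage under `q` whose loops are null-homotopic. -/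
structure GoodSet (q : X → W) (U : Set W) : Prop where
  isOpen : IsOpen U
  isPathConnected : IsPathConnected (q ⁻¹' U)
  loops : LoopsNullhomotopic (q ⁻¹' U)

variable {q : X → W}

/-- For each good set, a path from `x` to a base point of its preimage is followed by a path inside
the preimage. The second path is unique up to homotopy in `X` because loops there are inessential.
-/
theorem exists_coordinates [PathConnectedSpace X] (x : X) :
    ∃ c : {U : Set W // GoodSet q U} → ∀ y : X, Homotopic.Quotient x y,
      ∀ i a b (δ : Path a b), (∀ t, q (δ t) ∈ i.1) → c i b = (c i a).trans (.mk δ) := by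
  classical
  refine ⟨fun i y => if h : q y ∈ i.1 then
    (Homotopic.Quotient.mk (PathConnectedSpace.somePath x i.2.isPathConnected.nonempty.some)).trans
      (.mk (i.2.isPathConnected.joinedIn _ i.2.isPathConnected.nonempty.some_mem y h).somePath)
    -- An arbitrary value off the preimage of `i`, where the coordinate is never constrained.
    else .mk (PathConnectedSpace.somePath x y), ?_⟩
  intro i a b δ hδ
  have ha : q a ∈ i.1 := by simpa using hδ 0
  have hb : q b ∈ i.1 := by simpa using hδ 1
  simp only [ha, hb, dite_true]
  rw [Homotopic.Quotient.trans_assoc]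
  refine congrArg (Homotopic.Quotient.trans _) ?_
  rw [← Homotopic.Quotient.mk_trans]
  exact (i.2.loops.mk_eq _ _ (fun t => JoinedIn.somePath_mem _ t)
    (trans_mem (fun t => JoinedIn.somePath_mem _ t) hδ))

variable {x : X} {c : {U : Set W // GoodSet q U} → ∀ y : X, Homotopic.Quotient x y}

/-- Moving inside a common smaller good set multiplies both coordinates on the right by the same
class, which cancels. This makes the transition functions locally constant. -/
theorem transition_eq
    (hc : ∀ i a b (δ : Path a b), (∀ t, q (δ t) ∈ i.1) → c i b = (c i a).trans (.mk δ))
    (i j : {U : Set W // GoodSet q U}) {U : Set W} (hU : GoodSet q U) (hi : U ⊆ i.1)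
    (hj : U ⊆ j.1) {y y' : X} (hy : q y ∈ U) (hy' : q y' ∈ U) :
    (c i y').trans (c j y').symm = (c i y).trans (c j y).symm := by
  obtain ⟨δ, hδ⟩ := hU.isPathConnected.joinedIn y hy y' hy'
  rw [hc i y y' δ fun t => hi (hδ t), hc j y y' δ fun t => hj (hδ t)]
  exact trans_trans_symm_trans _ _ _

/-- The covering of `W` whose fibre over `w` consists of the classes of paths of `X` from `x` to
the fibre of `q` over `w`. -/
noncomputable def pathCore (hb : ∀ w, ∀ U₀ ∈ 𝓝 w, ∃ U ⊆ U₀, w ∈ U ∧ GoodSet q U)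
    (s : W → X) (hs : ∀ w, q (s w) = w)
    (hc : ∀ i a b (δ : Path a b), (∀ t, q (δ t) ∈ i.1) → c i b = (c i a).trans (.mk δ))
    [TopologicalSpace (Homotopic.Quotient x x)] [DiscreteTopology (Homotopic.Quotient x x)] :
    FiberBundleCore {U : Set W // GoodSet q U} W (Homotopic.Quotient x x) where
  baseSet i := i.1
  isOpen_baseSet i := i.2.isOpen
  indexAt w := ⟨(hb w univ univ_mem).choose, (hb w univ univ_mem).choose_spec.2.2⟩
  mem_baseSet_at w := (hb w univ univ_mem).choose_spec.2.1
  -- The choice `s w` of a point over `w` need not be continuous: by `transition_eq` the transition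
  -- does not depend on it.
  coordChange i j w g := g.trans ((c i (s w)).trans (c j (s w)).symm)
  coordChange_self i w _ g := by simp
  continuousOn_coordChange i j := by
    rintro ⟨w, g⟩ ⟨hw, -⟩
    refine ContinuousAt.continuousWithinAt ?_
    obtain ⟨U, hU, hwU, hg⟩ := hb w (i.1 ∩ j.1) ((i.2.isOpen.inter j.2.isOpen).mem_nhds hw)
    have hcont : Continuous fun p : W × Homotopic.Quotient x x =>
        p.2.trans ((c i (s w)).trans (c j (s w)).symm) :=
      continuous_of_discreteTopology.comp continuous_snd
    refine hcont.continuousAt.congr ?_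
    filter_upwards [continuous_fst.continuousAt.preimage_mem_nhds (hg.isOpen.mem_nhds hwU)]
      with p hp
    rw [transition_eq hc i j hg (fun _ h => (hU h).1) (fun _ h => (hU h).2) (y := s w) (y' := s p.1)
      (by rwa [hs]) (by rw [hs]; exact hp)]
  coordChange_comp i j k w _ g := by
    rw [Homotopic.Quotient.trans_assoc, Homotopic.Quotient.trans_assoc,
      ← Homotopic.Quotient.trans_assoc (c j (s w)).symm]
    simp

/-- The class of the restriction of a path to `[0, t]`. -/
noncomputable def initialClass {x y : X} (γ : Path x y) (t : I) : Homotopic.Quotient x (γ t) :=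
  (Homotopic.Quotient.mk (γ.subpath 0 t)).cast γ.source.symm rfl

theorem initialClass_trans {x y : X} (γ : Path x y) (t t' : I) :
    initialClass γ t' = (initialClass γ t).trans (.mk (γ.subpath t t')) := by
  unfold initialClass
  rw [← Homotopic.Quotient.eq.2 ⟨Path.Homotopy.subpathTransSubpath γ 0 t t'⟩]
  rfl

/-- The image of a path lifts to the covering by recording the class of its initial segments. The
endpoint of this lift determines the class of the path, and it depends only on the homotopy class of
the image. -/
theorem injective_of_goodSets [PathConnectedSpace X] (hq : Continuous q)
    (hqs : Function.Surjective q)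
    (hb : ∀ w, ∀ U₀ ∈ 𝓝 w, ∃ U ⊆ U₀, w ∈ U ∧ GoodSet q U) {x y : X} (γ γ' : Path x y)
    (h : (γ.map hq).Homotopic (γ'.map hq)) : γ.Homotopic γ' := by
  obtain ⟨c, hc⟩ := exists_coordinates (q := q) x
  let _ : TopologicalSpace (Homotopic.Quotient x x) := ⊥
  have : DiscreteTopology (Homotopic.Quotient x x) := ⟨rfl⟩
  obtain ⟨s, hs⟩ := hqs.hasRightInverse
  let Z := pathCore hb s hs hc
  have cov : IsCoveringMap (Bundle.TotalSpace.proj : Z.TotalSpace → W) :=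
    FiberBundle.isCoveringMap
  let lift (γ : Path x y) (t : I) : Z.TotalSpace :=
    ⟨q (γ t), (initialClass γ t).trans (c (Z.indexAt (q (γ t))) (γ t)).symm⟩
  -- The lift has the same expression in every chart, so its continuity at a point may be checked in
  -- one fixed chart.
  have hcoord : ∀ (i : {U : Set W // GoodSet q U}) (γ : Path x y) (t : I), q (γ t) ∈ i.1 →
      Z.coordChange (Z.indexAt (q (γ t))) i (q (γ t)) (lift γ t).2 =
        (initialClass γ t).trans (c i (γ t)).symm := by
    intro i γ t ht
    let k := Z.indexAt (q (γ t))
    obtain ⟨U, hU, hwU, hg⟩ := hb (q (γ t)) (k.1 ∩ i.1)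
      ((k.2.isOpen.inter i.2.isOpen).mem_nhds ⟨Z.mem_baseSet_at _, ht⟩)
    have h1 := transition_eq hc k i hg (fun _ h => (hU h).1) (fun _ h => (hU h).2)
      (y := γ t) (y' := s (q (γ t))) hwU (by rw [hs]; exact hwU)
    change ((initialClass γ t).trans (c k (γ t)).symm).trans
      ((c k (s (q (γ t)))).trans (c i (s (q (γ t)))).symm) = _
    rw [h1, Homotopic.Quotient.trans_assoc, ← Homotopic.Quotient.trans_assoc (c k (γ t)).symm]
    simp
  have hcont : ∀ γ : Path x y, Continuous (lift γ) := by
    intro γ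
    refine continuous_iff_continuousAt.2 fun t₀ => ?_
    rw [FiberBundle.continuousAt_totalSpace]
    refine ⟨(hq.comp γ.continuous).continuousAt, ?_⟩
    let i := Z.indexAt (q (γ t₀))
    have hev : ∀ᶠ t in 𝓝 t₀, ∀ r : I, q (γ.subpath t₀ t r) ∈ i.1 := by
      have hK : Continuous fun p : I × I => q (γ.subpath t₀ p.1 p.2) := by
        have := γ.subpath_continuous_family
        exact hq.comp (this.comp (f := fun p : I × I => (t₀, p.1, p.2)) (by fun_prop))
      have := isCompact_univ.eventually_forall_of_forall_eventually (x₀ := t₀) (K := (univ : Set I))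
        (P := fun t r => q (γ.subpath t₀ t r) ∈ i.1) (fun r _ => by
          refine hK.continuousAt.preimage_mem_nhds (i.2.isOpen.mem_nhds ?_)
          change q (γ.subpath t₀ t₀ r) ∈ i.1
          rw [Path.subpath_self]
          exact Z.mem_baseSet_at (q (γ t₀)))
      simpa using this
    -- In the chart `i` the fibre coordinate is constant near `t₀`: the new arc enters both factors
    -- and cancels.
    refine (continuousAt_const (y := (initialClass γ t₀).trans (c i (γ t₀)).symm)).congr ?_
    filter_upwards [hev] with t ht
    have hti : q (γ t) ∈ i.1 := by simpa using ht 1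
    refine Eq.trans ?_ (hcoord i γ t hti).symm
    rw [initialClass_trans γ t₀ t, hc i _ _ _ ht]
    exact (trans_trans_symm_trans _ _ _).symm
  have hone : ∀ γ : Path x y, lift γ 1 =
      ⟨q y, (Homotopic.Quotient.mk γ).trans (c (Z.indexAt (q y)) y).symm⟩ := by
    intro γ
    have : ∀ (z : X) (hz : z = y), (⟨q z, ((Homotopic.Quotient.mk γ).cast rfl hz).trans
      (c (Z.indexAt (q z)) z).symm⟩ : Z.TotalSpace) =
      ⟨q y, (Homotopic.Quotient.mk γ).trans (c (Z.indexAt (q y)) y).symm⟩ := by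
      rintro z rfl
      rfl
    refine Eq.trans ?_ (this (γ 1) γ.target)
    simp only [lift, initialClass, Path.subpath_zero_one]
    rfl
  have hzero : ∀ γ : Path x y, lift γ 0 =
      ⟨q x, (c (Z.indexAt (q x)) x).symm⟩ := by
    intro γ
    have : ∀ (z : X) (hz : z = x), (⟨q z, ((Homotopic.Quotient.mk (.refl z)).cast hz.symm rfl).trans
      (c (Z.indexAt (q z)) z).symm⟩ : Z.TotalSpace) =
      ⟨q x, (c (Z.indexAt (q x)) x).symm⟩ := by
      rintro z rfl
      simp
    refine Eq.trans ?_ (this (γ 0) γ.source)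
    simp only [lift, initialClass, Path.subpath_self]
  have hlift : ∀ γ : Path x y, lift γ = cov.liftPath (γ.map hq) (lift γ 0) (by simp [lift]) :=
    fun γ => (cov.eq_liftPath_iff _).2 ⟨hcont γ, rfl, rfl⟩
  have hend : lift γ 1 = lift γ' 1 := by
    rw [hlift γ, hlift γ']
    have h0 : lift γ 0 = lift γ' 0 := by rw [hzero, hzero]
    simp only [h0]
    exact cov.liftPath_apply_one_eq_of_homotopicRel h _ _ _
  rw [hone, hone] at hend
  have hend' := eq_of_heq (Bundle.TotalSpace.mk.inj hend).2
  rw [← Homotopic.Quotient.eq]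
  have := congrArg (fun g => Homotopic.Quotient.trans g (c (Z.indexAt (q y)) y)) hend'
  simpa using this

/-- The section lifts `δ`; paths inside the end fibres correct its endpoints, and `q` collapses them
to constant paths. -/
theorem exists_lift_trans (hq : Continuous q) (hfib : ∀ w, IsPathConnected (q ⁻¹' {w}))
    {U : Set W} {τ : W → X} (hτ : ContinuousOn τ U) (hτq : ∀ u ∈ U, q (τ u) = u)
    {a e : X} {w w' : W} (η : Path a e) (he : q e = w) (δ : Path w w') (hδ : ∀ t, δ t ∈ U)
    {e' : X} (he' : q e' = w') : ∃ η' : Path a e',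
      (Homotopic.Quotient.mk (η'.map hq)).cast rfl he'.symm =
        ((Homotopic.Quotient.mk (η.map hq)).cast rfl he.symm).trans (.mk δ) := by
  subst he he'
  have h0 : q (τ (q e)) = q e := hτq _ (by simpa using hδ 0)
  have h1 : q (τ (q e')) = q e' := hτq _ (by simpa using hδ 1)
  obtain ⟨φ, hφ⟩ := (hfib (q e)).joinedIn e rfl (τ (q e)) h0
  obtain ⟨φ', hφ'⟩ := (hfib (q e')).joinedIn (τ (q e')) h1 e' rfl
  let ψ : Path (τ (q e)) (τ (q e')) := δ.map' (hτ.mono (range_subset_iff.2 hδ))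
  refine ⟨((η.trans φ).trans ψ).trans φ', ?_⟩
  have e1 : φ.map hq = (Path.refl (q e)).cast rfl h0 := by
    ext t; exact hφ t
  have e2 : φ'.map hq = (Path.refl (q e')).cast h1 rfl := by
    ext t; exact hφ' t
  have e3 : ψ.map hq = δ.cast h0 h1 := by
    ext t; exact hτq _ (hδ t)
  rw [Path.map_trans, Path.map_trans, Path.map_trans, e1, e2, e3]
  have e4 : ((((η.map hq).trans ((Path.refl (q e)).cast rfl h0)).trans (δ.cast h0 h1)).trans
      ((Path.refl (q e')).cast h1 rfl)) =
      (((η.map hq).trans (Path.refl (q e))).trans δ).trans (Path.refl (q e')) := rfl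
  rw [e4]
  simp

theorem exists_lift_of_sections (hq : Continuous q) (hfib : ∀ w, IsPathConnected (q ⁻¹' {w}))
    (hsec : ∀ w, ∃ U ∈ 𝓝 w, ∃ τ : W → X, ContinuousOn τ U ∧ ∀ u ∈ U, q (τ u) = u)
    {a b : X} (γ : Path (q a) (q b)) : ∃ η : Path a b, (η.map hq).Homotopic γ := by
  -- Liftability of the initial arc up to homotopy is locally constant in `t`, by extending or
  -- retracing a short arc inside the domain of a section.
  let S : I → Prop := fun t => ∃ (e : X) (he : q e = γ t) (η : Path a e),
    (Homotopic.Quotient.mk (η.map hq)).cast rfl he.symm = initialClass γ t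
  have hloc : IsLocallyConstant S := by
    rw [IsLocallyConstant.iff_eventually_eq]
    intro t₀
    obtain ⟨U, hU, τ, hτ, hτq⟩ := hsec (γ t₀)
    have hev : ∀ᶠ t in 𝓝 t₀, ∀ r : I, γ.subpath t₀ t r ∈ U := by
      have hK : Continuous fun p : I × I => γ.subpath t₀ p.1 p.2 :=
        γ.subpath_continuous_family.comp (f := fun p : I × I => (t₀, p.1, p.2)) (by fun_prop)
      have := isCompact_univ.eventually_forall_of_forall_eventually (x₀ := t₀) (K := (univ : Set I))
        (P := fun t r => γ.subpath t₀ t r ∈ U) (fun r _ => by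
          refine hK.continuousAt.preimage_mem_nhds ?_
          change U ∈ 𝓝 (γ.subpath t₀ t₀ r)
          rw [Path.subpath_self]
          exact hU)
      simpa using this
    have step : ∀ t t' : I, (∀ r, γ.subpath t t' r ∈ U) → S t → S t' := by
      rintro t t' ht ⟨e, he, η, hη⟩
      have ht' : γ t' ∈ U := by simpa using ht 1
      obtain ⟨η', hη'⟩ := exists_lift_trans hq hfib hτ hτq η he (γ.subpath t t') ht
        (e' := τ (γ t')) (hτq _ ht')
      exact ⟨_, hτq _ ht', η', by rw [hη', hη, ← initialClass_trans]⟩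
    filter_upwards [hev] with t ht
    refine propext ⟨step t t₀ fun r => ?_, step t₀ t ht⟩
    rw [← Path.symm_subpath]
    exact ht _
  have h0 : S 0 := by
    refine ⟨a, γ.source.symm, Path.refl a, ?_⟩
    simp only [initialClass, Path.subpath_self, ← Homotopic.Quotient.mk_cast]
    congr 1
    ext t
    exact γ.source.symm
  have h1 : S 1 := (hloc.apply_eq_of_preconnectedSpace 0 1) ▸ h0
  obtain ⟨e, he, η, hη⟩ := h1
  obtain ⟨U, hU, τ, hτ, hτq⟩ := hsec (q b)
  -- Lifting a constant path moves the endpoint of the lift to the prescribed `b` within its fibre.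
  obtain ⟨η', hη'⟩ := exists_lift_trans hq hfib hτ hτq η (he.trans γ.target) (Path.refl (q b))
    (fun _ => mem_of_mem_nhds hU) (e' := b) rfl
  refine ⟨η', ?_⟩
  rw [← Homotopic.Quotient.eq]
  rw [Homotopic.Quotient.cast_rfl_rfl] at hη'
  rw [hη']
  have := congrArg (fun p => Homotopic.Quotient.cast p rfl γ.target.symm) hη
  simp only [initialClass, Path.subpath_zero_one, Homotopic.Quotient.cast_cast,
    Homotopic.Quotient.mk_cast] at this
  rw [this]
  simp

/-- A map with path-connected fibres and local sections, whose target has a basis of open sets with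
path-connected preimages that contain no essential loops, induces isomorphisms of fundamental
groups. -/
theorem nonempty_fundamentalGroup_mulEquiv [PathConnectedSpace X] (hq : Continuous q)
    (hqs : Function.Surjective q) (hfib : ∀ w, IsPathConnected (q ⁻¹' {w}))
    (hb : ∀ w, ∀ U₀ ∈ 𝓝 w, ∃ U ⊆ U₀, w ∈ U ∧ GoodSet q U)
    (hsec : ∀ w, ∃ U ∈ 𝓝 w, ∃ τ : W → X, ContinuousOn τ U ∧ ∀ u ∈ U, q (τ u) = u)
    (x : X) (w : W) : Nonempty (FundamentalGroup X x ≃* FundamentalGroup W w) := by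
  have : PathConnectedSpace W := hqs.pathConnectedSpace hq
  let f : C(X, W) := ⟨q, hq⟩
  have hbij : Function.Bijective (FundamentalGroup.map f x) := by
    constructor
    · intro p p' h
      obtain ⟨γ, rfl⟩ := Homotopic.Quotient.mk_surjective p
      obtain ⟨γ', rfl⟩ := Homotopic.Quotient.mk_surjective p'
      exact Homotopic.Quotient.eq.2
        (injective_of_goodSets hq hqs hb γ γ' (Homotopic.Quotient.eq.1 h))
    · intro p
      obtain ⟨γ, rfl⟩ := Homotopic.Quotient.mk_surjective p
      obtain ⟨η, hη⟩ := exists_lift_of_sections hq hfib hsec (a := x) (b := x) γ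
      exact ⟨Homotopic.Quotient.mk η, Homotopic.Quotient.eq.2 hη⟩
  exact ⟨(MulEquiv.ofBijective _ hbij).trans
    (FundamentalGroup.fundamentalGroupMulEquivOfPathConnected (f x) w)⟩

end Covering

/-! ### Gluing local motions between nearby fibres. -/

section Lift

variable {X E : Type*} [TopologicalSpace X] [NormedAddCommGroup E]

/-- `T` moves the points of `V` to the fibres over the ball of radius `r` around `y₀`, and fixes the
points that are already there. -/
structure IsLift (F : X → E) (y₀ : E) (V : Set X) (r : ℝ) (T : X × E → X) : Prop where
  isOpen : IsOpen V
  pos : 0 < r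
  mem_ball : ∀ x ∈ V, F x ∈ Metric.ball y₀ r
  continuousOn : ContinuousOn T (V ×ˢ Metric.ball y₀ r)
  apply_lift : ∀ x ∈ V, ∀ y ∈ Metric.ball y₀ r, F (T (x, y)) = y
  lift_self : ∀ x ∈ V, T (x, F x) = x

/-- A neighbourhood of `K` admits a lift. -/
def HasLift (F : X → E) (y₀ : E) (K : Set X) : Prop :=
  ∃ V r T, IsLift F y₀ V r T ∧ K ⊆ V

variable {F : X → E} {y₀ : E}

theorem HasLift.mono {K L : Set X} (h : HasLift F y₀ L) (hKL : K ⊆ L) : HasLift F y₀ K := by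
  obtain ⟨V, r, T, hT, hV⟩ := h
  exact ⟨V, r, T, hT, hKL.trans hV⟩

theorem hasLift_empty : HasLift F y₀ ∅ :=
  ⟨∅, 1, Prod.fst, ⟨isOpen_empty, one_pos, by simp, by simp, by simp, by simp⟩, Subset.rfl⟩

variable [NormedSpace ℝ E]

/-- A cutoff `ρ`, equal to `1` near `K`, makes the first lift carry a point only the fraction `ρ` of
the way to the target value. The second lift completes the journey near `L`. -/
theorem HasLift.union [NormalSpace X] (hF : Continuous F) {K L : Set X}
    (hK : HasLift F y₀ K) (hL : HasLift F y₀ L) (hKc : IsClosed K) (hLc : IsCompact L)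
    (hKy : K ⊆ F ⁻¹' {y₀}) (hLy : L ⊆ F ⁻¹' {y₀}) : HasLift F y₀ (K ∪ L) := by
  classical
  obtain ⟨V₁, r₁, T₁, h₁, hKV₁⟩ := hK
  obtain ⟨V₂, r₂, T₂, h₂, hLV₂⟩ := hL
  obtain ⟨B, hBo, hKB, hBV⟩ := normal_exists_closure_subset hKc h₁.isOpen hKV₁
  obtain ⟨A, hAo, hKA, hAB⟩ := normal_exists_closure_subset hKc hBo hKB
  obtain ⟨ρ, hρ0, hρ1, hρI⟩ := exists_continuous_zero_one_of_isClosed hBo.isClosed_compl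
    isClosed_closure (disjoint_compl_left_iff_subset.2 hAB)
  set r := min r₁ r₂
  have hr : 0 < r := lt_min h₁.pos h₂.pos
  have hr₁ : Metric.ball y₀ r ⊆ Metric.ball y₀ r₁ := Metric.ball_subset_ball (min_le_left _ _)
  have hr₂ : Metric.ball y₀ r ⊆ Metric.ball y₀ r₂ := Metric.ball_subset_ball (min_le_right _ _)
  let m : X × E → E := fun z => AffineMap.lineMap (F z.1) z.2 (ρ z.1)
  have hm : Continuous m := by
    simp only [m, AffineMap.lineMap_apply_module]
    fun_prop
  let Φ : X × E → X := fun z => if z.1 ∈ V₁ then T₁ (z.1, m z) else z.1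
  let Ω : Set (X × E) := (F ⁻¹' Metric.ball y₀ r) ×ˢ Metric.ball y₀ r
  have hΩ : IsOpen Ω := (Metric.isOpen_ball.preimage hF).prod Metric.isOpen_ball
  have hmΩ : ∀ z ∈ Ω, m z ∈ Metric.ball y₀ r := fun z hz =>
    (convex_ball y₀ r).lineMap_mem hz.1 hz.2 (hρI z.1)
  have hρV : ∀ x, x ∉ V₁ → ρ x = 0 := fun x hx => hρ0 fun hxB => hx (hBV (subset_closure hxB))
  have hFΦ : ∀ z ∈ Ω, F (Φ z) = m z := by
    intro z hz
    by_cases h : z.1 ∈ V₁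
    · simp only [Φ, h, if_true]
      exact h₁.apply_lift _ h _ (hr₁ (hmΩ z hz))
    · simp [Φ, m, h, hρV _ h]
  have hΦself : ∀ x y, y = F x ∨ ρ x = 0 → Φ (x, y) = x := by
    intro x y hy
    have hmx : m (x, y) = F x := by
      rcases hy with rfl | h
      · simp [m]
      · simp [m, h]
    by_cases h : x ∈ V₁
    · simp only [Φ, h, if_true, hmx]
      exact h₁.lift_self _ h
    · simp [Φ, h]
  have hΦc : ContinuousOn Φ Ω := by
    intro z hz
    refine ContinuousAt.continuousWithinAt ?_
    by_cases h : z.1 ∈ V₁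
    · have hc : ContinuousAt (fun z : X × E => T₁ (z.1, m z)) z := by
        have : ContinuousAt T₁ (z.1, m z) := h₁.continuousOn.continuousAt
          ((h₁.isOpen.prod Metric.isOpen_ball).mem_nhds ⟨h, hr₁ (hmΩ z hz)⟩)
        exact ContinuousAt.comp (f := fun z : X × E => (z.1, m z)) this
          (continuous_fst.prodMk hm).continuousAt
      refine hc.congr ?_
      filter_upwards [continuous_fst.continuousAt.preimage_mem_nhds (h₁.isOpen.mem_nhds h)]
        with z' hz'
      have hz'' : z'.1 ∈ V₁ := hz'
      simp [Φ, hz'']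
    · refine continuous_fst.continuousAt.congr ?_
      have : z.1 ∈ (closure B)ᶜ := fun h' => h (hBV h')
      filter_upwards [continuous_fst.continuousAt.preimage_mem_nhds
        (isClosed_closure.isOpen_compl.mem_nhds this)] with z' hz'
      exact (hΦself z'.1 z'.2 (Or.inr (hρ0 fun h => hz' (subset_closure h)))).symm
  have hΩ₂ : IsOpen (Ω ∩ Φ ⁻¹' V₂) := hΦc.isOpen_inter_preimage hΩ h₂.isOpen
  -- At value `y₀` the partial motion fixes `L`, so near `L` and for values near `y₀` it lands in
  -- the domain of the second lift.
  obtain ⟨u, v, huo, hvo, hLu, hyv, huv⟩ := generalized_tube_lemma hLc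
    (isCompact_singleton (x := y₀)) hΩ₂ (by
      rintro ⟨x, y⟩ ⟨hx, rfl⟩
      have hFx : F x = y := hLy hx
      refine ⟨⟨by simp [hFx, hr], by simp [hr]⟩, ?_⟩
      rw [mem_preimage, hΦself x y (Or.inl hFx.symm)]
      exact hLV₂ hx)
  obtain ⟨r₃, hr₃, hr₃v⟩ := Metric.isOpen_iff.1 hvo y₀ (hyv rfl)
  set r' := min r r₃
  have hr' : 0 < r' := lt_min hr hr₃
  have hr'r : Metric.ball y₀ r' ⊆ Metric.ball y₀ r := Metric.ball_subset_ball (min_le_left _ _)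
  have hr'v : Metric.ball y₀ r' ⊆ v := (Metric.ball_subset_ball (min_le_right _ _)).trans hr₃v
  let V : Set X := (A ∪ u) ∩ F ⁻¹' Metric.ball y₀ r'
  have hVΩ : ∀ z ∈ V ×ˢ Metric.ball y₀ r', z ∈ Ω := fun z hz => ⟨hr'r hz.1.2, hr'r hz.2⟩
  -- On `u` the two cases agree, since `T₂` fixes points already over the target; on `A` only the
  -- first case occurs. This gives continuity on `V`.
  let T : X × E → X := fun z => if ρ z.1 = 1 then Φ z else T₂ (Φ z, z.2)
  have hVo : IsOpen V := (hAo.union huo).inter (Metric.isOpen_ball.preimage hF)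
  have hρA : ∀ x ∈ A, ρ x = 1 := fun x hx => hρ1 (subset_closure hx)
  have hTu : ∀ z ∈ V ×ˢ Metric.ball y₀ r', z.1 ∈ u → Φ z ∈ V₂ ∧ T z = T₂ (Φ z, z.2) := by
    intro z hz hzu
    have hzV : Φ z ∈ V₂ := (huv ⟨hzu, hr'v hz.2⟩ : z ∈ Ω ∩ Φ ⁻¹' V₂).2
    refine ⟨hzV, ?_⟩
    by_cases h : ρ z.1 = 1
    · have hz2 : F (Φ z) = z.2 := by simp [hFΦ z (hVΩ z hz), m, h]
      simp only [T, h, if_true]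
      rw [← hz2, h₂.lift_self _ hzV]
    · simp [T, h]
  refine ⟨V, r', T, ⟨hVo, hr', fun x hx => hx.2, ?_, ?_, ?_⟩, ?_⟩
  · intro z hz
    refine ContinuousAt.continuousWithinAt ?_
    have hnhds : V ×ˢ Metric.ball y₀ r' ∈ 𝓝 z := (hVo.prod Metric.isOpen_ball).mem_nhds hz
    have hΦz : ContinuousAt Φ z := hΦc.continuousAt (hΩ.mem_nhds (hVΩ z hz))
    rcases hz.1.1 with hA | hu
    · refine hΦz.congr ?_
      filter_upwards [continuous_fst.continuousAt.preimage_mem_nhds (hAo.mem_nhds hA)] with z' hz'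
      simp [T, hρA z'.1 hz']
    · have hc : ContinuousAt (fun z : X × E => T₂ (Φ z, z.2)) z := by
        have : ContinuousAt T₂ (Φ z, z.2) := h₂.continuousOn.continuousAt
          ((h₂.isOpen.prod Metric.isOpen_ball).mem_nhds ⟨(hTu z hz hu).1, hr₂ (hr'r hz.2)⟩)
        exact ContinuousAt.comp (f := fun z : X × E => (Φ z, z.2)) this
          (hΦz.prodMk continuousAt_snd)
      refine hc.congr ?_
      filter_upwards [hnhds, continuous_fst.continuousAt.preimage_mem_nhds (huo.mem_nhds hu)]
        with z' hz' hz'u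
      exact (hTu z' hz' hz'u).2.symm
  · intro x hx y hy
    by_cases h : ρ x = 1
    · simp only [T, h, if_true]
      rw [hFΦ _ (hVΩ _ ⟨hx, hy⟩)]
      simp [m, h]
    · have hxu : x ∈ u := hx.1.resolve_left fun hA => h (hρA x hA)
      obtain ⟨h3, h4⟩ := hTu (x, y) ⟨hx, hy⟩ hxu
      rw [h4]
      exact h₂.apply_lift _ h3 _ (hr₂ (hr'r hy))
  · intro x hx
    have hΦx : Φ (x, F x) = x := hΦself x _ (Or.inl rfl)
    by_cases h : ρ x = 1
    · simp [T, h, hΦx]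
    · have hxu : x ∈ u := hx.1.resolve_left fun hA => h (hρA x hA)
      obtain ⟨h3, h4⟩ := hTu (x, F x) ⟨hx, hx.2⟩ hxu
      rw [h4, hΦx]
      exact h₂.lift_self _ (hΦx ▸ h3)
  · rintro x (hx | hx)
    · exact ⟨Or.inl (hKA hx), by
        have : F x = y₀ := hKy hx
        simp [this, hr']⟩
    · exact ⟨Or.inr (hLu hx), by
        have : F x = y₀ := hLy hx
        simp [this, hr']⟩

theorem hasLift_of_isCompact [CompactSpace X] [T2Space X] (hF : Continuous F) {C : Set X}
    (hC : IsCompact C) (hCy : C ⊆ F ⁻¹' {y₀}) (h : ∀ x ∈ C, HasLift F y₀ {x}) :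
    HasLift F y₀ C := by
  suffices HasLift F y₀ (closure C ∩ C) by
    rwa [inter_eq_self_of_subset_right subset_closure] at this
  -- The closure keeps the pieces closed, as gluing requires.
  refine hC.induction_on (p := fun s => HasLift F y₀ (closure s ∩ C)) ?_ ?_ ?_ ?_
  · simpa using hasLift_empty
  · exact fun s t hst ht => ht.mono (inter_subset_inter_left _ (closure_mono hst))
  · intro s t hs ht
    rw [closure_union, union_inter_distrib_right]
    exact hs.union hF ht (isClosed_closure.inter hC.isClosed)
      (isClosed_closure.inter hC.isClosed).isCompact (inter_subset_right.trans hCy)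
      (inter_subset_right.trans hCy)
  · intro x hx
    obtain ⟨V, r, T, hT, hV⟩ := h x hx
    obtain ⟨t, htx, htc, htV⟩ := exists_mem_nhds_isClosed_subset
      (hT.isOpen.mem_nhds (hV (mem_singleton x)))
    refine ⟨t, mem_nhdsWithin_of_mem_nhds htx, V, r, T, hT, ?_⟩
    rw [htc.closure_eq]
    exact inter_subset_left.trans htV

end Lift

/-! ### Components of fibres. -/

section Fibre

variable {X Y : Type*} [TopologicalSpace X] {F : X → Y}

/-- The component of the point `p` in its fibre. -/
def fibreComponent (F : X → Y) (p : X) : Set X :=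
  connectedComponentIn (F ⁻¹' {F p}) p

theorem mem_fibreComponent (p : X) : p ∈ fibreComponent F p :=
  mem_connectedComponentIn rfl

theorem fibreComponent_subset (p : X) : fibreComponent F p ⊆ F ⁻¹' {F p} :=
  connectedComponentIn_subset _ _

theorem mk_eq_mk_iff {x y : X} :
    (Quotient.mk (reebSetoid F) x) = Quotient.mk (reebSetoid F) y ↔ y ∈ fibreComponent F x := by
  rw [Quotient.eq]
  exact ⟨fun h => h.2, fun h => ⟨(fibreComponent_subset x h).symm, h⟩⟩

theorem preimage_mk (p : X) :
    Quotient.mk (reebSetoid F) ⁻¹' {Quotient.mk (reebSetoid F) p} = fibreComponent F p := by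
  ext x
  rw [mem_preimage, mem_singleton_iff, eq_comm, mk_eq_mk_iff]

theorem mem_fibreComponent_of_joinedIn {p x : X} (h : JoinedIn (F ⁻¹' {F p}) p x) :
    x ∈ fibreComponent F p := by
  obtain ⟨γ, hγ⟩ := h
  have : range γ ⊆ fibreComponent F p :=
    (isPreconnected_range γ.continuous).subset_connectedComponentIn ⟨0, γ.source⟩
      (range_subset_iff.2 hγ)
  exact this ⟨1, γ.target⟩

theorem joinedIn_fibreComponent {p x y : X} (hx : x ∈ fibreComponent F p)
    (h : JoinedIn (F ⁻¹' {F p}) x y) : JoinedIn (fibreComponent F p) x y := by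
  obtain ⟨γ, hγ⟩ := h
  have hr : range γ ⊆ fibreComponent F p := by
    rw [fibreComponent, connectedComponentIn_eq hx]
    exact (isPreconnected_range γ.continuous).subset_connectedComponentIn ⟨0, γ.source⟩
      (range_subset_iff.2 hγ)
  exact ⟨γ, fun t => hr (mem_range_self t)⟩

theorem isClosed_fibreComponent [TopologicalSpace Y] [T1Space Y] (hF : Continuous F) (p : X) :
    IsClosed (fibreComponent F p) := by
  have hc : IsPreconnected (closure (fibreComponent F p)) :=
    isPreconnected_connectedComponentIn.closure
  exact isClosed_of_closure_subset (hc.subset_connectedComponentIn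
    (subset_closure (mem_fibreComponent p))
    (closure_minimal (fibreComponent_subset p) (isClosed_singleton.preimage hF)))

theorem fibreComponent_eq_singleton [T1Space X] {p : X} {V : Set X} (hV : IsOpen V) (hp : p ∈ V)
    (h : ∀ x ∈ V, F x = F p → x = p) : fibreComponent F p = {p} := by
  refine Subset.antisymm (fun x hx => ?_) (singleton_subset_iff.2 (mem_fibreComponent p))
  by_contra hxp
  obtain ⟨z, hz, hzV, hzp⟩ := (isPreconnected_connectedComponentIn : IsPreconnected
    (fibreComponent F p)) V {p}ᶜ hV isOpen_compl_singleton (fun z _ => by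
      by_cases hz : z = p
      · exact Or.inl (hz ▸ hp)
      · exact Or.inr hz) ⟨p, mem_fibreComponent p, hp⟩ ⟨x, hx, hxp⟩
  exact hzp (h z hzV (fibreComponent_subset p hz))

end Fibre

/-! ### Saturated tubes around fibre components. -/

section Tube

variable {X Y E : Type*} [TopologicalSpace X] [NormedAddCommGroup E] [NormedSpace ℝ E]

/-- `G` is a coordinate for the values of `F` on the neighbourhood `V` of `C`, with values in the
convex set `D`, and `T` moves the points of `V` to all the fibres with coordinate in `D`. -/
structure IsTube (F : X → Y) (C V : Set X) (D : Set E) (c : E) (G : X → E) (T : X × E → X) :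
    Prop where
  isOpen : IsOpen V
  subset : C ⊆ V
  convex : Convex ℝ D
  continuousOn_coord : ContinuousOn G V
  coord_mem : ∀ x ∈ V, G x ∈ D
  coord_center : ∀ x ∈ C, G x = c
  coord_eq : ∀ x ∈ V, ∀ x' ∈ V, F x = F x' → G x = G x'
  continuousOn : ContinuousOn T (V ×ˢ D)
  coord_lift : ∀ x ∈ V, ∀ y ∈ D, T (x, y) ∈ V → G (T (x, y)) = y
  apply_lift : ∀ x ∈ V, ∀ x' ∈ V, ∀ y ∈ D, F (T (x, y)) = F (T (x', y))
  lift_self : ∀ x ∈ V, T (x, G x) = x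

/-- A tube around the component of `p` in its fibre that is a union of components of fibres and is
preserved by the lift. -/
structure IsSaturatedTube (F : X → Y) (p : X) (V : Set X) (D : Set E) (c : E) (G : X → E)
    (T : X × E → X) : Prop extends IsTube F (fibreComponent F p) V D c G T where
  lift_mem : ∀ x ∈ V, ∀ y ∈ D, T (x, y) ∈ V
  fibreComponent_subset : ∀ x ∈ V, fibreComponent F x ⊆ V
  mem_of_eq : ∀ x ∈ V, F x = F p → x ∈ fibreComponent F p
  isPathConnected : IsPathConnected (fibreComponent F p)

variable {F : X → Y} {p : X} {V : Set X} {D : Set E} {c : E} {G : X → E} {T : X × E → X}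

/-- The component and the rest of its fibre have disjoint neighbourhoods `A` and `O₂`. Nearby fibres
lie in their union, so any connected set in such fibres that meets `A` stays in `A`; shrinking the
coordinate set then yields saturation. -/
theorem IsTube.exists_isSaturatedTube [TopologicalSpace Y] [CompactSpace X] [T2Space X]
    [T2Space Y] (hF : Continuous F)
    (h : IsTube F (fibreComponent F p) V D c G T) (hpc : IsPathConnected (fibreComponent F p))
    (hcl : IsClosed (F ⁻¹' {F p} \ fibreComponent F p)) {O : Set X} (hO : IsOpen O)
    (hCO : fibreComponent F p ⊆ O) :
    ∃ V' ⊆ O, ∃ D' : Set E, IsSaturatedTube F p V' D' c G T := by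
  have hCc := isClosed_fibreComponent hF p
  obtain ⟨O₁, O₂, hO₁, hO₂, hC₁, hR₂, hd⟩ := normal_separation hCc hcl disjoint_sdiff_right
  set A := O₁ ∩ (V ∩ O)
  have hA : IsOpen A := hO₁.inter (h.isOpen.inter hO)
  have hCA : fibreComponent F p ⊆ A := fun x hx => ⟨hC₁ hx, h.subset hx, hCO hx⟩
  have hdA : Disjoint A O₂ := hd.mono_left inter_subset_left
  -- The values whose entire fibre lies in `A ∪ O₂`; this set is open because `F` is closed on a
  -- compact space.
  set B : Set Y := (F '' (A ∪ O₂)ᶜ)ᶜ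
  have hB : IsOpen B :=
    ((hA.union hO₂).isClosed_compl.isCompact.image hF).isClosed.isOpen_compl
  have hFB : ∀ x, F x ∈ B → x ∈ A ∪ O₂ := fun x hx => by
    by_contra hx'
    exact hx ⟨x, hx', rfl⟩
  have hpB : F p ∈ B := by
    rintro ⟨x, hx, hxp⟩
    by_cases hxC : x ∈ fibreComponent F p
    · exact hx (Or.inl (hCA hxC))
    · exact hx (Or.inr (hR₂ ⟨hxp, hxC⟩))
  have hpV : p ∈ V := h.subset (mem_fibreComponent p)
  have hGp : G p = c := h.coord_center p (mem_fibreComponent p)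
  have hcD : c ∈ D := hGp ▸ h.coord_mem p hpV
  have hs : ContinuousOn (fun y => F (T (p, y))) D :=
    hF.comp_continuousOn (h.continuousOn.comp (f := fun y => (p, y)) (by fun_prop)
      fun y hy => ⟨hpV, hy⟩)
  have hFTp : F (T (p, c)) = F p := by rw [← hGp, h.lift_self p hpV]
  obtain ⟨r, hr, hrB⟩ := Metric.mem_nhdsWithin_iff.1
    ((hs c hcD).preimage_mem_nhdsWithin (hB.mem_nhds (by simpa only [hFTp] using hpB)))
  have hFT : ∀ x ∈ V, ∀ y ∈ D ∩ Metric.ball c r, F (T (x, y)) ∈ B := by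
    intro x hx y hy
    rw [h.apply_lift x hx p hpV y hy.1]
    exact hrB ⟨hy.2, hy.1⟩
  have hAV : A ⊆ V := fun x hx => hx.2.1
  let V' : Set X := A ∩ G ⁻¹' Metric.ball c r
  have hV'A : V' ⊆ A := inter_subset_left
  have hV'V : V' ⊆ V := hV'A.trans hAV
  have hconv : Convex ℝ (D ∩ Metric.ball c r) := h.convex.inter (convex_ball c r)
  have hGV' : ∀ x ∈ V', G x ∈ D ∩ Metric.ball c r := fun x hx => ⟨h.coord_mem x (hV'V hx), hx.2⟩
  have hV'B : ∀ x ∈ V', F x ∈ B := fun x hx => by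
    have := hFT x (hV'V hx) (G x) (hGV' x hx)
    rwa [h.lift_self x (hV'V hx)] at this
  refine ⟨V', fun x hx => (hV'A hx).2.2, D ∩ Metric.ball c r, ?_⟩
  refine ⟨⟨(h.continuousOn_coord.mono hAV).isOpen_inter_preimage hA Metric.isOpen_ball,
    fun x hx => ⟨hCA hx, ?_⟩, hconv, h.continuousOn_coord.mono hV'V, hGV', h.coord_center,
    fun x hx x' hx' => h.coord_eq x (hV'V hx) x' (hV'V hx'),
    h.continuousOn.mono (prod_mono hV'V inter_subset_left),
    fun x hx y hy hT => h.coord_lift x (hV'V hx) y hy.1 (hV'V hT),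
    fun x hx x' hx' y hy => h.apply_lift x (hV'V hx) x' (hV'V hx') y hy.1,
    fun x hx => h.lift_self x (hV'V hx)⟩, ?_, ?_, ?_, hpc⟩
  · simp [h.coord_center x hx, hr]
  · intro x hx y hy
    have hTA : T (x, y) ∈ A := by
      -- This path starts at `x` in `A` and runs over values in `B`, so it cannot cross into `O₂`.
      let f : ℝ → X := fun t => T (x, AffineMap.lineMap (G x) y t)
      have hmem : ∀ t ∈ Icc (0 : ℝ) 1, (AffineMap.lineMap (G x) y t : E) ∈ D ∩ Metric.ball c r :=
        fun t ht => hconv.lineMap_mem (hGV' x hx) hy ht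
      have hf : ContinuousOn f (Icc 0 1) :=
        h.continuousOn.comp (f := fun t : ℝ => (x, (AffineMap.lineMap (G x) y t : E)))
          (by
            simp only [AffineMap.lineMap_apply_module]
            fun_prop)
          fun t ht => ⟨hV'V hx, (hmem t ht).1⟩
      have hsub : f '' Icc 0 1 ⊆ A := by
        refine IsPreconnected.subset_left_of_subset_union hA hO₂ hdA ?_ ?_
          (isPreconnected_Icc.image f hf)
        · rintro _ ⟨t, ht, rfl⟩
          exact hFB _ (hFT x (hV'V hx) _ (hmem t ht))
        · exact ⟨x, ⟨0, by simp, by simp [f, h.lift_self x (hV'V hx)]⟩, hV'A hx⟩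
      exact hsub ⟨1, by simp, by simp [f]⟩
    refine ⟨hTA, ?_⟩
    rw [mem_preimage, h.coord_lift x (hV'V hx) y hy.1 (hAV hTA)]
    exact hy.2
  · intro x hx
    have hsub : fibreComponent F x ⊆ A :=
      IsPreconnected.subset_left_of_subset_union hA hO₂ hdA
        (fun z hz => hFB _ ((fibreComponent_subset x hz : F z = F x) ▸ hV'B x hx))
        ⟨x, mem_fibreComponent x, hV'A hx⟩ isPreconnected_connectedComponentIn
    intro z hz
    refine ⟨hsub hz, ?_⟩
    rw [mem_preimage, h.coord_eq z (hAV (hsub hz)) x (hV'V hx) (fibreComponent_subset x hz)]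
    exact hx.2
  · intro x hx hxp
    by_contra hxC
    exact hdA.le_bot ⟨hV'A hx, hR₂ ⟨hxp, hxC⟩⟩

namespace IsSaturatedTube

theorem continuous_line (h : IsSaturatedTube F p V D c G T) {x : I → X} (hx : Continuous x)
    (hxV : ∀ t, x t ∈ V)
    {y y' : I → E} (hy : Continuous y) (hy' : Continuous y') (hyD : ∀ t, y t ∈ D)
    (hyD' : ∀ t, y' t ∈ D) :
    Continuous fun z : I × I => T (x z.2, AffineMap.lineMap (y z.2) (y' z.2) (z.1 : ℝ)) := by
  have hc : Continuous fun z : I × I =>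
      (x z.2, (AffineMap.lineMap (y z.2) (y' z.2) (z.1 : ℝ) : E)) := by
    simp only [AffineMap.lineMap_apply_module]
    fun_prop
  exact h.continuousOn.comp_continuous hc fun z =>
    ⟨hxV _, h.convex.lineMap_mem (hyD _) (hyD' _) z.1.2⟩

theorem center_mem (h : IsSaturatedTube F p V D c G T) : c ∈ D := by
  rw [← h.coord_center p (mem_fibreComponent p)]
  exact h.coord_mem p (h.subset (mem_fibreComponent p))

theorem apply_lift_center (h : IsSaturatedTube F p V D c G T) {x : X} (hx : x ∈ V) :
    T (x, c) ∈ fibreComponent F p := by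
  have hp := h.subset (mem_fibreComponent p)
  refine h.mem_of_eq _ (h.lift_mem x hx c h.center_mem) ?_
  rw [h.apply_lift x hx p hp c h.center_mem, ← h.coord_center p (mem_fibreComponent p),
    h.lift_self p hp]

theorem apply_lift_coord (h : IsSaturatedTube F p V D c G T) {a b : X} (ha : a ∈ V) (hb : b ∈ V) :
    F (T (a, G b)) = F b := by
  rw [h.apply_lift a ha b hb _ (h.coord_mem b hb), h.lift_self b hb]

/-- The line from the coordinate of a point to `y` lifts to a path. -/
theorem joinedIn_lift (h : IsSaturatedTube F p V D c G T) {x : X} (hx : x ∈ V) {y : E}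
    (hy : y ∈ D) : JoinedIn V x (T (x, y)) := by
  have hc := h.continuous_line (x := fun _ => x) (y := fun _ => G x) (y' := fun _ => y)
    continuous_const (fun _ => hx) continuous_const continuous_const
    (fun _ => h.coord_mem x hx) (fun _ => hy)
  refine ⟨⟨⟨fun t => T (x, AffineMap.lineMap (G x) y (t : ℝ)),
    hc.comp (f := fun t : I => (t, (0 : I))) (by fun_prop)⟩, ?_, ?_⟩, ?_⟩
  · simp [h.lift_self x hx]
  · simp
  · exact fun t => h.lift_mem x hx _ (h.convex.lineMap_mem (h.coord_mem x hx) hy t.2)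

theorem isPathConnected_domain (h : IsSaturatedTube F p V D c G T) : IsPathConnected V := by
  have hp := h.subset (mem_fibreComponent p)
  refine ⟨p, hp, fun {x} hx => ?_⟩
  have h1 := h.joinedIn_lift hx h.center_mem
  have h2 := (h.isPathConnected.joinedIn p (mem_fibreComponent p) _ (h.apply_lift_center hx)).mono
    h.subset
  exact h2.trans h1.symm

theorem joinedIn_fibre (h : IsSaturatedTube F p V D c G T) {a b : X} (ha : a ∈ V) (hb : b ∈ V)
    (hab : F a = F b) :
    JoinedIn (F ⁻¹' {F a}) a b := by
  -- The path from `x` to the central component is pushed into the fibre of `a`. There only paths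
  -- within the central component, likewise pushed, are needed to connect the ends.
  have key : ∀ x ∈ V, F x = F a → JoinedIn (F ⁻¹' {F a}) x (T (T (x, c), G a)) := by
    intro x hx hxa
    have hGx : G x = G a := h.coord_eq x hx a ha hxa
    obtain ⟨γ, hγ⟩ := h.joinedIn_lift hx h.center_mem
    have hcont : Continuous fun t => T (γ t, G a) :=
      h.continuousOn.comp_continuous (f := fun t => (γ t, G a)) (by fun_prop)
        fun t => ⟨hγ t, h.coord_mem a ha⟩
    refine ⟨⟨⟨_, hcont⟩, ?_, ?_⟩, fun t => h.apply_lift_coord (hγ t) ha⟩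
    · simp [← hGx, h.lift_self x hx]
    · simp
  obtain ⟨γ, hγ⟩ := h.isPathConnected.joinedIn _ (h.apply_lift_center ha) _
    (h.apply_lift_center hb)
  have hmid : JoinedIn (F ⁻¹' {F a}) (T (T (a, c), G a)) (T (T (b, c), G a)) := by
    have hcont : Continuous fun t => T (γ t, G a) :=
      h.continuousOn.comp_continuous (f := fun t => (γ t, G a)) (by fun_prop)
        fun t => ⟨h.subset (hγ t), h.coord_mem a ha⟩
    exact ⟨⟨⟨_, hcont⟩, by simp, by simp⟩, fun t => h.apply_lift_coord (h.subset (hγ t)) ha⟩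
  exact ((key a ha rfl).trans hmid).trans (key b hb hab.symm).symm

theorem mem_fibreComponent_iff (h : IsSaturatedTube F p V D c G T) {a b : X} (ha : a ∈ V) :
    b ∈ fibreComponent F a ↔ b ∈ V ∧ F b = F a :=
  ⟨fun hb => ⟨h.fibreComponent_subset a ha hb, LocallyInessential.fibreComponent_subset a hb⟩,
    fun hb => mem_fibreComponent_of_joinedIn (h.joinedIn_fibre ha hb.1 hb.2.symm)⟩

theorem preimage_image_mk (h : IsSaturatedTube F p V D c G T) :
    Quotient.mk (reebSetoid F) ⁻¹' (Quotient.mk (reebSetoid F) '' V) = V := by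
  refine Subset.antisymm ?_ (subset_preimage_image _ _)
  rintro x ⟨y, hy, hyx⟩
  exact h.fibreComponent_subset y hy (mk_eq_mk_iff.1 hyx)

theorem isOpen_image_mk (h : IsSaturatedTube F p V D c G T) :
    IsOpen (Quotient.mk (reebSetoid F) '' V : Set (ReebSpace F)) := by
  refine isQuotientMap_quotient_mk'.isOpen_preimage.1 ?_
  change IsOpen (Quotient.mk (reebSetoid F) ⁻¹' (Quotient.mk (reebSetoid F) '' V))
  rw [h.preimage_image_mk]
  exact h.isOpen

/-- The coordinate `G` descends to the Reeb space, and moving the single point `p` to each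
coordinate value gives the section. -/
theorem exists_section (h : IsSaturatedTube F p V D c G T) : ∃ τ : ReebSpace F → X,
    ContinuousOn τ (Quotient.mk (reebSetoid F) '' V) ∧
      ∀ u ∈ (Quotient.mk (reebSetoid F) '' V), Quotient.mk (reebSetoid F) (τ u) = u := by
  have hp := h.subset (mem_fibreComponent p)
  have hout : ∀ x ∈ V, Quotient.out (Quotient.mk (reebSetoid F) x) ∈ V ∧
      F (Quotient.out (Quotient.mk (reebSetoid F) x)) = F x := fun x hx =>
    (h.mem_fibreComponent_iff hx).1 (mk_eq_mk_iff.1 (Quotient.out_eq _).symm)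
  have hG : ∀ x ∈ V, G (Quotient.out (Quotient.mk (reebSetoid F) x)) = G x := fun x hx =>
    h.coord_eq _ (hout x hx).1 x hx (hout x hx).2
  refine ⟨fun w => T (p, G w.out), ?_, ?_⟩
  · refine (isQuotientMap_quotient_mk'.continuousOn_isOpen_iff h.isOpen_image_mk).2 ?_
    have hc : ContinuousOn (fun x => T (p, G x)) V :=
      h.continuousOn.comp (f := fun x => (p, G x))
        (continuousOn_const.prodMk h.continuousOn_coord) fun x hx => ⟨hp, h.coord_mem x hx⟩
    refine (hc.congr fun x hx => ?_).mono h.preimage_image_mk.subset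
    exact congrArg (fun y => T (p, y)) (hG x hx)
  · rintro _ ⟨x, hx, rfl⟩
    beta_reduce
    rw [eq_comm, mk_eq_mk_iff, hG x hx, h.mem_fibreComponent_iff hx]
    exact ⟨h.lift_mem p hp _ (h.coord_mem x hx), h.apply_lift_coord hp hx⟩

/-- Contracting the coordinates of a loop linearly to `G b` gives a free homotopy to a loop in the
fibre component of `b`. -/
theorem loopsNullhomotopic (h : IsSaturatedTube F p V D c G T) {b : X} (hb : b ∈ V)
    (hl : LoopsNullhomotopic (fibreComponent F b)) : LoopsNullhomotopic V := by
  intro a γ hγ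
  have hGγ : Continuous fun t => G (γ t) := h.continuousOn_coord.comp_continuous γ.continuous hγ
  have hc := h.continuous_line (y' := fun _ => G b) γ.continuous hγ hGγ continuous_const
    (fun t => h.coord_mem _ (hγ t)) (fun _ => h.coord_mem b hb)
  have hc' : Continuous fun t => T (γ t, G b) :=
    h.continuousOn.comp_continuous (f := fun t => (γ t, G b)) (by fun_prop)
      fun t => ⟨hγ t, h.coord_mem b hb⟩
  refine homotopic_refl_of_free_homotopy ⟨_, hc⟩ γ
    (⟨⟨_, hc'⟩, by simp, by simp⟩ : Path (T (a, G b)) (T (a, G b))) ?_ ?_ ?_ ?_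
  · exact fun t => by simp [h.lift_self _ (hγ t)]
  · exact fun t => by simp
  · exact fun s => by simp
  · refine hl _ fun t => ?_
    rw [h.mem_fibreComponent_iff hb]
    exact ⟨h.lift_mem _ (hγ t) _ (h.coord_mem b hb), h.apply_lift_coord (hγ t) hb⟩

end IsSaturatedTube

end Tube

/-! ### Tubes everywhere, and the comparison with the Reeb space. -/

section Reeb

variable {X E : Type*} [TopologicalSpace X] [NormedAddCommGroup E] {F : X → E} {p : X}

/-- A short path in `X` between two points of the fibre is pushed into the fibre by the lift, with
its endpoints fixed. -/
theorem HasLift.eventually_joinedIn [LocallyPathConnectedSpace X] (h : HasLift F (F p) {p}) :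
    ∀ᶠ x in 𝓝 p, F x = F p → JoinedIn (F ⁻¹' {F p}) p x := by
  obtain ⟨V, r, T, hT, hV⟩ := h
  obtain ⟨A, ⟨hA, hAc⟩, hAV⟩ := (path_connected_basis p).mem_iff.1
    (hT.isOpen.mem_nhds (hV (mem_singleton p)))
  filter_upwards [hA] with x hx hxp
  obtain ⟨γ, hγ⟩ := hAc.joinedIn p (mem_of_mem_nhds hA) x hx
  have hy : F p ∈ Metric.ball (F p) r := Metric.mem_ball_self hT.pos
  have hc : Continuous fun t => T (γ t, F p) :=
    hT.continuousOn.comp_continuous (f := fun t => (γ t, F p)) (by fun_prop)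
      fun t => ⟨hAV (hγ t), hy⟩
  refine ⟨⟨⟨_, hc⟩, ?_, ?_⟩, fun t => hT.apply_lift _ (hAV (hγ t)) _ hy⟩
  · simp [hT.lift_self p (hV rfl)]
  · simp only [Path.target]
    rw [← hxp, hT.lift_self x (hAV hx)]

theorem eventually_joinedIn_fibreComponent [LocallyPathConnectedSpace X]
    (h : ∀ x ∈ fibreComponent F p, HasLift F (F p) {x}) {x : X} (hx : x ∈ fibreComponent F p) :
    ∀ᶠ y in 𝓝 x, F y = F p → JoinedIn (fibreComponent F p) x y := by
  have hxp : F x = F p := fibreComponent_subset p hx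
  have := h x hx
  rw [← hxp] at this
  filter_upwards [this.eventually_joinedIn] with y hy hyp
  rw [hxp] at hy
  exact joinedIn_fibreComponent hx (hy hyp)

theorem isPathConnected_fibreComponent [LocallyPathConnectedSpace X]
    (h : ∀ x ∈ fibreComponent F p, HasLift F (F p) {x}) :
    IsPathConnected (fibreComponent F p) := by
  refine ⟨p, mem_fibreComponent p, fun {x} hx => ?_⟩
  refine IsPreconnected.induction₂ (isPreconnected_connectedComponentIn (F := F ⁻¹' {F p}) (x := p))
    (fun a b => JoinedIn (fibreComponent F p) a b) (fun a ha => ?_)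
    (fun a b c _ _ _ hab hbc => hab.trans hbc) (fun a b _ _ hab => hab.symm)
    (mem_fibreComponent p) hx
  filter_upwards [mem_nhdsWithin_of_mem_nhds (eventually_joinedIn_fibreComponent h ha),
    self_mem_nhdsWithin] with b hb hbC
  exact hb (fibreComponent_subset p hbC)

theorem isClosed_fibre_diff_fibreComponent [LocallyPathConnectedSpace X] (hF : Continuous F)
    (h : ∀ x ∈ fibreComponent F p, HasLift F (F p) {x}) :
    IsClosed (F ⁻¹' {F p} \ fibreComponent F p) := by
  have hc : IsClosed (F ⁻¹' {F p}) := isClosed_singleton.preimage hF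
  rw [← isOpen_compl_iff, isOpen_iff_mem_nhds]
  intro x hx
  by_cases hxF : x ∈ F ⁻¹' {F p}
  · have hxC : x ∈ fibreComponent F p := by
      by_contra hxC
      exact hx ⟨hxF, hxC⟩
    filter_upwards [eventually_joinedIn_fibreComponent h hxC] with y hy hy'
    exact hy'.2 (hy hy'.1).target_mem
  · filter_upwards [hc.isOpen_compl.mem_nhds hxF] with y hy hy'
    exact hy hy'.1

variable [NormedSpace ℝ E]

theorem HasLift.exists_isTube {C : Set X} {y₀ : E} (h : HasLift F y₀ C) (hF : Continuous F)
    (hC : C ⊆ F ⁻¹' {y₀}) : ∃ V D T, IsTube F C V D y₀ F T := by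
  obtain ⟨V, r, T, hT, hV⟩ := h
  exact ⟨V, Metric.ball y₀ r, T, hT.isOpen, hV, convex_ball _ _, hF.continuousOn,
    hT.mem_ball, fun x hx => hC hx,
    fun _ _ _ _ h => h, hT.continuousOn, fun x hx y hy _ => hT.apply_lift x hx y hy,
    fun x hx x' hx' y hy => (hT.apply_lift x hx y hy).trans (hT.apply_lift x' hx' y hy).symm,
    hT.lift_self⟩

/-- The point `p` is isolated in its fibre and has a tube. -/
def IsIsolatedTubePoint (F : X → E) (p : X) : Prop :=
  ∃ (V : Set X) (D : Set E) (c : E) (G : X → E) (T : X × E → X),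
    IsTube F {p} V D c G T ∧ ∀ x ∈ V, F x = F p → x = p

theorem IsIsolatedTubePoint.fibreComponent_eq [T1Space X] (h : IsIsolatedTubePoint F p) :
    fibreComponent F p = {p} := by
  obtain ⟨V, D, c, G, T, hT, hV⟩ := h
  exact fibreComponent_eq_singleton hT.isOpen (hT.subset rfl) hV

/-- A component containing an isolated tube point is just that point; every other component consists
of points with lifts, which glue by compactness. -/
theorem exists_isSaturatedTube [CompactSpace X] [T2Space X] [LocallyPathConnectedSpace X]
    (hF : Continuous F) (h : ∀ p, HasLift F (F p) {p} ∨ IsIsolatedTubePoint F p) (p : X)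
    {O : Set X} (hO : IsOpen O) (hCO : fibreComponent F p ⊆ O) :
    ∃ V ⊆ O, ∃ (D : Set E) (c : E) (G : X → E) (T : X × E → X),
      IsSaturatedTube F p V D c G T := by
  by_cases hex : ∃ a ∈ fibreComponent F p, IsIsolatedTubePoint F a
  · obtain ⟨a, ha, hia⟩ := hex
    have hpa : p ∈ fibreComponent F a := mk_eq_mk_iff.1 (mk_eq_mk_iff.2 ha).symm
    rw [hia.fibreComponent_eq, mem_singleton_iff] at hpa
    subst hpa
    have hC := hia.fibreComponent_eq
    obtain ⟨V, D, c, G, T, hT, hV⟩ := hia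
    have hcl : IsClosed (F ⁻¹' {F p} \ fibreComponent F p) := by
      have : F ⁻¹' {F p} \ fibreComponent F p = F ⁻¹' {F p} ∩ Vᶜ := by
        ext x
        rw [hC]
        refine and_congr_right fun hx => not_congr ⟨fun h => ?_, fun h => hV x h hx⟩
        rw [mem_singleton_iff.1 h]
        exact hT.subset rfl
      rw [this]
      exact (isClosed_singleton.preimage hF).inter hT.isOpen.isClosed_compl
    have hpc : IsPathConnected (fibreComponent F p) := by
      rw [hC]
      exact isPathConnected_singleton p
    rw [← hC] at hT
    obtain ⟨V', hV'O, D', h'⟩ := hT.exists_isSaturatedTube hF hpc hcl hO hCO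
    exact ⟨V', hV'O, D', c, G, T, h'⟩
  · have hlift : ∀ x ∈ fibreComponent F p, HasLift F (F p) {x} := by
      intro x hx
      have := (h x).resolve_right fun hx' => hex ⟨x, hx, hx'⟩
      rwa [show F x = F p from fibreComponent_subset p hx] at this
    obtain ⟨V, D, T, hT⟩ := (hasLift_of_isCompact hF (isClosed_fibreComponent hF p).isCompact
      (fibreComponent_subset p) hlift).exists_isTube hF (fibreComponent_subset p)
    obtain ⟨V', hV'O, D', h'⟩ := hT.exists_isSaturatedTube hF (isPathConnected_fibreComponent hlift)
      (isClosed_fibre_diff_fibreComponent hF hlift) hO hCO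
    exact ⟨V', hV'O, D', _, _, T, h'⟩

/-- If all points had lifts, `F` would have open image; the image is also compact, hence all of `E`,
which is not compact. -/
theorem exists_isIsolatedTubePoint [CompactSpace X] [Nonempty X] [NoncompactSpace E]
    (hF : Continuous F) (h : ∀ p, HasLift F (F p) {p} ∨ IsIsolatedTubePoint F p) :
    ∃ p, IsIsolatedTubePoint F p := by
  by_contra! hno
  have hopen : IsOpen (range F) := by
    rw [isOpen_iff_mem_nhds]
    rintro _ ⟨p, rfl⟩
    obtain ⟨V, r, T, hT, hV⟩ := (h p).resolve_right (hno p)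
    filter_upwards [Metric.ball_mem_nhds (F p) hT.pos] with y hy
    exact ⟨T (p, y), hT.apply_lift p (hV rfl) y hy⟩
  have hclosed : IsClosed (range F) := (isCompact_range hF).isClosed
  have huniv : range F = univ := IsClopen.eq_univ ⟨hclosed, hopen⟩ (range_nonempty F)
  exact noncompact_univ E (huniv ▸ isCompact_range hF)

theorem nonempty_fundamentalGroup_mulEquiv_reebSpace [CompactSpace X] [T2Space X]
    [ConnectedSpace X] [LocallyPathConnectedSpace X] [NoncompactSpace E]
    (hF : Continuous F) (h : ∀ p, HasLift F (F p) {p} ∨ IsIsolatedTubePoint F p)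
    (x : X) (w : ReebSpace F) :
    Nonempty (FundamentalGroup X x ≃* FundamentalGroup (ReebSpace F) w) := by
  have hpath : PathConnectedSpace X := pathConnectedSpace_iff_connectedSpace.2 inferInstance
  let q : X → ReebSpace F := Quotient.mk (reebSetoid F)
  have hq : Continuous q := continuous_quotient_mk'
  have hqs : Function.Surjective q := Quotient.mk_surjective
  have htube := fun p O => exists_isSaturatedTube hF h p (O := O)
  have hfib : ∀ w, IsPathConnected (q ⁻¹' {w}) := by
    intro w
    obtain ⟨p, rfl⟩ := hqs w
    obtain ⟨V, -, D, c, G, T, hT⟩ := htube p univ isOpen_univ (subset_univ _)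
    rw [preimage_mk]
    exact hT.isPathConnected
  -- Tubes transfer the property between neighbouring fibres, and connectedness carries it from a
  -- one-point fibre to all of them.
  have hnull : ∀ w, LoopsNullhomotopic (q ⁻¹' {w}) := by
    have hloc : IsLocallyConstant fun w => LoopsNullhomotopic (q ⁻¹' {w}) := by
      rw [IsLocallyConstant.iff_eventually_eq]
      intro w
      obtain ⟨p, rfl⟩ := hqs w
      obtain ⟨V, -, D, c, G, T, hT⟩ := htube p univ isOpen_univ (subset_univ _)
      filter_upwards [hT.isOpen_image_mk.mem_nhds
        ⟨p, hT.subset (mem_fibreComponent p), rfl⟩]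
      rintro _ ⟨b, hb, rfl⟩
      have key : ∀ a ∈ V, ∀ b ∈ V, LoopsNullhomotopic (q ⁻¹' {q a}) →
          LoopsNullhomotopic (q ⁻¹' {q b}) := by
        intro a ha b hb hl
        rw [preimage_mk] at hl ⊢
        exact (hT.loopsNullhomotopic ha hl).mono (hT.fibreComponent_subset b hb)
      have hp := hT.subset (mem_fibreComponent p)
      exact propext ⟨key b hb p hp, key p hp b hb⟩
    obtain ⟨a, ha⟩ := exists_isIsolatedTubePoint hF h
    intro w
    have hw := hloc.apply_eq_of_preconnectedSpace (q a) w
    rw [← hw, preimage_mk, ha.fibreComponent_eq]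
    intro b γ hγ
    have : γ = Path.refl b := by
      ext t
      rw [mem_singleton_iff.1 (hγ t), Path.refl_apply, ← γ.source]
      exact (hγ 0).symm
    rw [this]
  refine nonempty_fundamentalGroup_mulEquiv hq hqs hfib ?_ ?_ x w
  · intro w U₀ hU₀
    obtain ⟨p, rfl⟩ := hqs w
    obtain ⟨O, hOU, hO, hpO⟩ := mem_nhds_iff.1 hU₀
    obtain ⟨V, hVO, D, c, G, T, hT⟩ := htube p _ (hO.preimage hq) (by
      rw [← preimage_mk]
      exact preimage_mono (singleton_subset_iff.2 hpO))
    have hp := hT.subset (mem_fibreComponent p)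
    refine ⟨q '' V, ?_, ⟨p, hp, rfl⟩, hT.isOpen_image_mk, ?_, ?_⟩
    · rintro _ ⟨b, hb, rfl⟩
      exact hOU (hVO hb)
    · rw [hT.preimage_image_mk]
      exact hT.isPathConnected_domain
    · rw [hT.preimage_image_mk]
      exact hT.loopsNullhomotopic hp (preimage_mk (F := F) p ▸ hnull (q p))
  · intro w
    obtain ⟨p, rfl⟩ := hqs w
    obtain ⟨V, -, D, c, G, T, hT⟩ := htube p univ isOpen_univ (subset_univ _)
    obtain ⟨τ, hτ, hτq⟩ := hT.exists_section
    exact ⟨_, hT.isOpen_image_mk.mem_nhds ⟨p, hT.subset (mem_fibreComponent p), rfl⟩, τ, hτ, hτq⟩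

end Reeb
end LocallyInessential

namespace LocallyInessential

open Set Filter Topology

/-! ### Solving equations on convex domains with boundary. -/

section Solve

open scoped NNReal

variable {E E' : Type*} [NormedAddCommGroup E] [NormedSpace ℝ E] [NormedAddCommGroup E']
  [NormedSpace ℝ E'] {f : E → E'} {s : Set E} {a : E}

/-- The derivative within `s` is continuous at `a`, and the mean value inequality applies on the
convex set `s ∩ ball`. -/
theorem exists_approximatesLinearOn (hs : Convex ℝ s) (ha : a ∈ s) (hu : UniqueDiffWithinAt ℝ s a)
    (hf : ContDiffWithinAt ℝ 1 f s a) {c : ℝ≥0} (hc : 0 < c) :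
    ∃ ε > 0, ApproximatesLinearOn f (fderivWithin ℝ f s a) (s ∩ Metric.ball a ε) c := by
  obtain ⟨u, hu', -, -, f', hf', hcont⟩ :=
    (contDiffWithinAt_succ_iff_hasFDerivWithinAt' (n := 0) (by simp)).1 (by simpa using hf)
  rw [insert_eq_of_mem ha] at hu'
  have hau : a ∈ u := mem_of_mem_nhdsWithin ha hu'
  have hfa : f' a = fderivWithin ℝ f s a := ((hf' a hau).fderivWithin hu).symm
  have hnear : {x | ‖f' x - f' a‖ < c} ∈ 𝓝[s] a := by
    have := hcont.continuousWithinAt.preimage_mem_nhdsWithin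
      (Metric.ball_mem_nhds (f' a) (NNReal.coe_pos.2 hc))
    simpa [Metric.ball, dist_eq_norm] using this
  obtain ⟨ε, hε, hsub⟩ := Metric.mem_nhdsWithin_iff.1 (inter_mem hu' hnear)
  refine ⟨ε, hε, ?_⟩
  rw [← hfa]
  intro x hx y hy
  exact (hs.inter (convex_ball a ε)).norm_image_sub_le_of_norm_hasFDerivWithin_le'
    (fun z hz => (hf' z (hsub ⟨hz.2, hz.1⟩).1).mono inter_subset_left)
    (fun z hz => (hsub ⟨hz.2, hz.1⟩).2.le) hy hx

/-- Solving `f (x + R z) = y` for `z`, where `R` is a right inverse of a linear approximation of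
`f` that preserves the domain `s` of `f`. -/
theorem exists_solution [CompleteSpace E'] {A : E →L[ℝ] E'} {R : E' →L[ℝ] E}
    (hAR : ∀ z, A (R z) = z)
    {c : ℝ≥0} {ε : ℝ} (hε : 0 < ε) (hf : ApproximatesLinearOn f A (s ∩ Metric.ball a ε) c)
    (hcR : c * ‖R‖₊ ≤ 1 / 2) (ha : a ∈ s) {η : ℝ} (hη : 0 < η)
    (hR : ∀ x ∈ s ∩ Metric.ball a η, ∀ z ∈ Metric.ball (0 : E') η, x + R z ∈ s) :
    ∃ δ > 0, ∃ Z : E × E' → E',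
      ContinuousOn Z ((s ∩ Metric.ball a δ) ×ˢ Metric.ball (f a) δ) ∧
      ∀ x ∈ s ∩ Metric.ball a δ,
        (∀ y ∈ Metric.ball (f a) δ, x + R (Z (x, y)) ∈ s ∩ Metric.ball a ε ∧
          f (x + R (Z (x, y))) = y) ∧
        Z (x, f x) = 0 := by
  classical
  obtain ⟨ε₁, hε₁, hball⟩ : ∃ ε₁ > 0, ∀ x ∈ s ∩ Metric.ball a ε₁,
      ∀ z ∈ Metric.closedBall (0 : E') ε₁, x + R z ∈ s ∩ Metric.ball a ε := by
    have hcont : ContinuousAt (fun p : E × E' => p.1 + R p.2) (a, 0) := by fun_prop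
    have hmem : (fun p : E × E' => p.1 + R p.2) ⁻¹' Metric.ball a ε ∈ 𝓝 (a, (0 : E')) :=
      hcont.preimage_mem_nhds (by simpa using Metric.ball_mem_nhds a hε)
    obtain ⟨κ, hκ, hκs⟩ := Metric.mem_nhds_iff.1 hmem
    have hmin : 0 < min κ η := lt_min hκ hη
    refine ⟨min κ η / 2, half_pos hmin, fun x hx z hz => ?_⟩
    have hx' : dist x a < min κ η := (Metric.mem_ball.1 hx.2).trans (half_lt_self hmin)
    have hz' : dist z 0 < min κ η := (Metric.mem_closedBall.1 hz).trans_lt (half_lt_self hmin)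
    refine ⟨hR x ⟨hx.1, hx'.trans_le (min_le_right _ _)⟩ z (hz'.trans_le (min_le_right _ _)), ?_⟩
    have : (x, z) ∈ Metric.ball (a, (0 : E')) κ := by
      rw [Metric.mem_ball, Prod.dist_eq]
      exact max_lt (hx'.trans_le (min_le_left _ _)) (hz'.trans_le (min_le_left _ _))
    exact hκs this
  -- Composing with `R` turns the linear part into the identity, with error at most `c * ‖R‖ ≤ 1 /
  -- 2`.
  have happrox : ∀ x ∈ s ∩ Metric.ball a ε₁, ApproximatesLinearOn (fun z => f (x + R z))
      (ContinuousLinearMap.id ℝ E') (Metric.closedBall 0 ε₁) (1 / 2) := by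
    intro x hx z hz z' hz'
    have h := hf _ (hball x hx z hz) _ (hball x hx z' hz')
    rw [add_sub_add_left_eq_sub, ← map_sub, hAR] at h
    refine h.trans ?_
    calc (c : ℝ) * ‖R (z - z')‖ ≤ c * (‖R‖ * ‖z - z'‖) := by gcongr; exact R.le_opNorm _
      _ = ((c * ‖R‖₊ : ℝ≥0) : ℝ) * ‖z - z'‖ := by push_cast; ring
      _ ≤ ((1 / 2 : ℝ≥0) : ℝ) * ‖z - z'‖ := by gcongr
  have hlower : ∀ x ∈ s ∩ Metric.ball a ε₁, ∀ z ∈ Metric.closedBall (0 : E') ε₁,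
      ∀ z' ∈ Metric.closedBall (0 : E') ε₁, ‖z - z'‖ ≤ 2 * ‖f (x + R z) - f (x + R z')‖ := by
    intro x hx z hz z' hz'
    have h := happrox x hx z hz z' hz'
    have h2 : ‖z - z'‖ ≤ ‖f (x + R z) - f (x + R z')‖ +
        ‖f (x + R z) - f (x + R z') - (z - z')‖ := by
      have := norm_sub_le (f (x + R z) - f (x + R z')) (f (x + R z) - f (x + R z') - (z - z'))
      simpa using this
    simp only [ContinuousLinearMap.id_apply] at h
    push_cast at h
    linarith
  have hfcont : ContinuousOn f (s ∩ Metric.ball a ε) := hf.continuousOn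
  have haε : a ∈ s ∩ Metric.ball a ε := ⟨ha, Metric.mem_ball_self hε⟩
  obtain ⟨δ₁, hδ₁, hδ₁f⟩ := Metric.mem_nhdsWithin_iff.1 ((hfcont a haε).preimage_mem_nhdsWithin
    (Metric.ball_mem_nhds (f a) (show 0 < ε₁ / 4 by positivity)))
  -- The map `z ↦ f (x + R z)` covers the ball of radius `(1 - 1 / 2) * ε₁` around `f x`; two errors
  -- of `ε₁ / 4` stay within it.
  set δ := min (min δ₁ ε) (ε₁ / 4)
  have hδ : 0 < δ := by positivity
  have hδε₁ : δ ≤ ε₁ / 4 := min_le_right _ _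
  have hsub : s ∩ Metric.ball a δ ⊆ s ∩ Metric.ball a ε₁ :=
    inter_subset_inter_right _ (Metric.ball_subset_ball (by linarith))
  have hfδ : ∀ x ∈ s ∩ Metric.ball a δ, dist (f x) (f a) < ε₁ / 4 := by
    intro x hx
    exact hδ₁f ⟨Metric.ball_subset_ball ((min_le_left _ _).trans (min_le_left _ _)) hx.2,
      hx.1, Metric.ball_subset_ball ((min_le_left _ _).trans (min_le_right _ _)) hx.2⟩
  have hex : ∀ x ∈ s ∩ Metric.ball a δ, ∀ y ∈ Metric.ball (f a) δ,
      ∃ z ∈ Metric.closedBall (0 : E') ε₁, f (x + R z) = y := by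
    intro x hx y hy
    let inv : (ContinuousLinearMap.id ℝ E').NonlinearRightInverse := ⟨id, 1, by simp, by simp⟩
    have := (happrox x (hsub hx)).surjOn_closedBall_of_nonlinearRightInverse inv hε₁.le Subset.rfl
    obtain ⟨z, hz, hzy⟩ := this (a := y) (by
      have h1 := hfδ x hx
      have h2 : dist y (f a) < δ := hy
      have h3 : dist y (f x) ≤ dist y (f a) + dist (f x) (f a) := dist_triangle_right _ _ _
      simp only [map_zero, add_zero, Metric.mem_closedBall, inv]
      push_cast
      linarith)
    exact ⟨z, hz, hzy⟩
  let Z : E × E' → E' := fun p =>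
    if h : ∃ z ∈ Metric.closedBall (0 : E') ε₁, f (p.1 + R z) = p.2 then h.choose else 0
  have hZ : ∀ x y, (∃ z ∈ Metric.closedBall (0 : E') ε₁, f (x + R z) = y) →
      Z (x, y) ∈ Metric.closedBall (0 : E') ε₁ ∧ f (x + R (Z (x, y))) = y := by
    intro x y h
    simp only [Z, h, dite_true]
    exact h.choose_spec
  refine ⟨δ, hδ, Z, ?_, fun x hx => ⟨fun y hy => ?_, ?_⟩⟩
  · rintro ⟨x₀, y₀⟩ ⟨hx₀, hy₀⟩
    obtain ⟨hz₀, hfz₀⟩ := hZ x₀ y₀ (hex x₀ hx₀ y₀ hy₀)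
    set z₀ := Z (x₀, y₀)
    set S := (s ∩ Metric.ball a δ) ×ˢ Metric.ball (f a) δ
    -- By `hlower` this quantity bounds the distance from `Z p` to `z₀`, and it vanishes at `(x₀,
    -- y₀)`.
    have hg : ContinuousWithinAt (fun p : E × E' => 2 * ‖p.2 - f (p.1 + R z₀)‖) S (x₀, y₀) := by
      have h1 : ContinuousWithinAt (fun p : E × E' => f (p.1 + R z₀)) S (x₀, y₀) :=
        (hfcont _ (hball x₀ (hsub hx₀) z₀ hz₀)).comp
          (f := fun p : E × E' => p.1 + R z₀) (by fun_prop)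
          fun p hp => hball p.1 (hsub hp.1) z₀ hz₀
      exact ((continuousWithinAt_snd.sub h1).norm).const_mul 2
    have hg0 : Tendsto (fun p : E × E' => 2 * ‖p.2 - f (p.1 + R z₀)‖) (𝓝[S] (x₀, y₀)) (𝓝 0) := by
      have := hg.tendsto
      simpa [hfz₀] using this
    refine tendsto_iff_norm_sub_tendsto_zero.2
      (squeeze_zero' (Eventually.of_forall fun _ => norm_nonneg _) ?_ hg0)
    filter_upwards [self_mem_nhdsWithin] with p hp
    obtain ⟨hz, hfz⟩ := hZ p.1 p.2 (hex p.1 hp.1 p.2 hp.2)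
    have := hlower p.1 (hsub hp.1) _ hz z₀ hz₀
    rwa [hfz] at this
  · obtain ⟨hz, hfz⟩ := hZ x y (hex x hx y hy)
    exact ⟨hball x (hsub hx) _ hz, hfz⟩
  · have h0 : (0 : E') ∈ Metric.closedBall (0 : E') ε₁ := Metric.mem_closedBall_self hε₁.le
    obtain ⟨hz, hfz⟩ := hZ x (f x) ⟨0, h0, by simp⟩
    have := hlower x (hsub hx) _ hz 0 h0
    simp only [hfz, map_zero, add_zero, sub_self, norm_zero, mul_zero, sub_zero] at this
    exact norm_le_zero_iff.1 this

end Solve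

/-! ### Lifts from right inverses of the differential. -/

section Manifold

variable {E E' H M : Type*} [NormedAddCommGroup E] [NormedSpace ℝ E] [NormedAddCommGroup E']
  [NormedSpace ℝ E'] [CompleteSpace E'] [TopologicalSpace H] {I : ModelWithCorners ℝ E H}
  [TopologicalSpace M] [ChartedSpace H M] {F : M → E'}

/-- In the chart at `p`, points move along the image of `R`; the last hypothesis keeps them inside
the model with boundary. -/
theorem hasLift_of_rightInverse (hF : ContMDiff I 𝓘(ℝ, E') 1 F) (p : M) (R : E' →L[ℝ] E)
    (hR : ∀ z, mfderiv I 𝓘(ℝ, E') F p (R z) = z) {η : ℝ} (hη : 0 < η)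
    (hRI : ∀ x ∈ range I ∩ Metric.ball (extChartAt I p p) η, ∀ z ∈ Metric.ball (0 : E') η,
      x + R z ∈ range I) : HasLift F (F p) {p} := by
  set e := extChartAt I p with he
  set a := e p
  have hp : p ∈ e.source := mem_extChartAt_source p
  set f : E → E' := F ∘ e.symm
  have hfa : f a = F p := by simp [f, a, e.left_inv hp]
  have ha : a ∈ range I := extChartAt_target_subset_range p (e.map_source hp)
  have hf : ContDiffWithinAt ℝ 1 f (range I) a := (contMDiffAt_iff.1 (hF p)).2
  have hA : mfderiv I 𝓘(ℝ, E') F p = fderivWithin ℝ f (range I) a :=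
    (hF.mdifferentiableAt one_ne_zero).mfderiv
  have hAR : ∀ z, fderivWithin ℝ f (range I) a (R z) = z := fun z => by
    rw [← hA]
    exact hR z
  -- The summand `1` in the constant keeps it positive and finite even when `R = 0`.
  obtain ⟨ε₁, hε₁, happ⟩ := exists_approximatesLinearOn I.convex_range ha (I.uniqueDiffOn a ha) hf
    (c := 1 / (2 * (‖R‖₊ + 1))) (by positivity)
  obtain ⟨ε₂, hε₂, htarget⟩ := Metric.mem_nhdsWithin_iff.1
    (extChartAt_target_mem_nhdsWithin (I := I) p)
  have hε : 0 < min ε₁ ε₂ := lt_min hε₁ hε₂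
  have hcR : 1 / (2 * (‖R‖₊ + 1)) * ‖R‖₊ ≤ 1 / 2 := by
    rw [← NNReal.coe_le_coe]
    push_cast
    rw [div_mul_eq_mul_div, one_mul, div_le_div_iff₀ (by positivity) (by positivity)]
    linarith
  obtain ⟨δ, hδ, Z, hZc, hZ⟩ := exists_solution hAR hε
    (happ.mono_set (inter_subset_inter_right _ (Metric.ball_subset_ball (min_le_left _ _))))
    hcR ha hη hRI
  rw [hfa] at hZc hZ
  have hsub : range I ∩ Metric.ball a (min ε₁ ε₂) ⊆ e.target := fun x hx =>
    htarget ⟨Metric.ball_subset_ball (min_le_right _ _) hx.2, hx.1⟩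
  let V : Set M := (e.source ∩ e ⁻¹' Metric.ball a δ) ∩ F ⁻¹' Metric.ball (F p) δ
  have hVs : ∀ x ∈ V, e x ∈ range I ∩ Metric.ball a δ := fun x hx =>
    ⟨extChartAt_target_subset_range p (e.map_source hx.1.1), hx.1.2⟩
  refine ⟨V, δ, fun z => e.symm (e z.1 + R (Z (e z.1, z.2))),
    ⟨?_, hδ, fun x hx => hx.2, ?_, ?_, ?_⟩, ?_⟩
  · exact ((continuousOn_extChartAt p).isOpen_inter_preimage (isOpen_extChartAt_source p)
      Metric.isOpen_ball).inter (Metric.isOpen_ball.preimage hF.continuous)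
  · have hec : ContinuousOn (fun z : M × E' => e z.1) (V ×ˢ Metric.ball (F p) δ) :=
      (continuousOn_extChartAt p).comp continuousOn_fst fun z hz => hz.1.1.1
    have hZc' : ContinuousOn (fun z : M × E' => Z (e z.1, z.2)) (V ×ˢ Metric.ball (F p) δ) :=
      hZc.comp (f := fun z : M × E' => (e z.1, z.2)) (hec.prodMk continuousOn_snd)
        fun z hz => ⟨hVs _ hz.1, hz.2⟩
    refine (continuousOn_extChartAt_symm p).comp (hec.add (R.continuous.comp_continuousOn hZc')) ?_
    exact fun z hz => hsub ((hZ _ (hVs _ hz.1)).1 _ hz.2).1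
  · exact fun x hx y hy => ((hZ _ (hVs _ hx)).1 y hy).2
  · intro x hx
    have hfx : F x = f (e x) := by simp [f, e.left_inv hx.1.1]
    have hZ0 : Z (e x, F x) = 0 := by
      rw [hfx]
      exact (hZ _ (hVs x hx)).2
    simp [hZ0, e.left_inv hx.1.1]
  · rintro _ rfl
    exact ⟨⟨hp, by simp [a, hδ]⟩, by simp [hδ]⟩

end Manifold

/-! ### Lifts at interior points and at regular boundary points. -/

section HalfSpace

variable {n m : ℕ} [NeZero n] {N : Type*} [TopologicalSpace N]
  [ChartedSpace (EuclideanHalfSpace n) N] {F : N → EuclideanSpace ℝ (Fin m)}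

theorem exists_rightInverse_of_map_eq_top {E E' : Type*} [NormedAddCommGroup E] [NormedSpace ℝ E]
    [NormedAddCommGroup E'] [NormedSpace ℝ E'] [FiniteDimensional ℝ E'] (A : E →L[ℝ] E')
    (S : Submodule ℝ E) (h : S.map A.toLinearMap = ⊤) :
    ∃ R : E' →L[ℝ] E, (∀ z, A (R z) = z) ∧ ∀ z, R z ∈ S := by
  have hr : LinearMap.range (A.toLinearMap.domRestrict S) = ⊤ := by
    rw [LinearMap.range_domRestrict, h]
  obtain ⟨g, hg⟩ := (A.toLinearMap.domRestrict S).exists_rightInverse_of_surjective hr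
  refine ⟨LinearMap.toContinuousLinearMap (S.subtype ∘ₗ g), fun z => ?_, fun z => (g z).2⟩
  exact LinearMap.congr_fun hg z

theorem hasLift_of_isInteriorPoint (hF : ContMDiff (𝓡∂ n) (𝓡 m) 1 F) {p : N}
    (hp : (𝓡∂ n).IsInteriorPoint p)
    (hs : Function.Surjective (mfderiv (𝓡∂ n) (𝓡 m) F p)) : HasLift F (F p) {p} := by
  obtain ⟨R, hR, -⟩ := exists_rightInverse_of_map_eq_top
    (E := EuclideanSpace ℝ (Fin n)) (E' := EuclideanSpace ℝ (Fin m))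
    (mfderiv (𝓡∂ n) (𝓡 m) F p) ⊤ (by
      rw [Submodule.map_top]
      exact LinearMap.range_eq_top.2 hs)
  set a := extChartAt (𝓡∂ n) p p
  have hmem : (fun q : EuclideanSpace ℝ (Fin n) × EuclideanSpace ℝ (Fin m) => q.1 + R q.2) ⁻¹'
      range (𝓡∂ n) ∈ 𝓝 (a, 0) := by
    have hc : ContinuousAt (fun q : EuclideanSpace ℝ (Fin n) × EuclideanSpace ℝ (Fin m) =>
      q.1 + R q.2) (a, 0) := by fun_prop
    refine hc.preimage_mem_nhds ?_
    rw [map_zero, add_zero]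
    exact mem_interior_iff_mem_nhds.1 hp
  obtain ⟨η, hη, hsub⟩ := Metric.mem_nhds_iff.1 hmem
  refine hasLift_of_rightInverse hF p R hR hη fun x hx z hz => ?_
  have : (x, z) ∈ Metric.ball (a, (0 : EuclideanSpace ℝ (Fin m))) η := by
    rw [Metric.mem_ball, Prod.dist_eq]
    exact max_lt hx.2 hz
  exact hsub this

/-- A right inverse with values tangent to the boundary leaves the coordinate of index `0`
unchanged, so the motion preserves the half-space. -/
theorem hasLift_of_map_boundaryTangentSpace (hF : ContMDiff (𝓡∂ n) (𝓡 m) 1 F) {p : N}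
    (hs : (BoundarySpecialGeneric.boundaryTangentSpace p).map
      (mfderiv (𝓡∂ n) (𝓡 m) F p).toLinearMap = ⊤) : HasLift F (F p) {p} := by
  obtain ⟨R, hR, hRS⟩ := exists_rightInverse_of_map_eq_top
    (E := EuclideanSpace ℝ (Fin n)) (E' := EuclideanSpace ℝ (Fin m))
    (mfderiv (𝓡∂ n) (𝓡 m) F p) (BoundarySpecialGeneric.boundaryTangentSpace p) hs
  refine hasLift_of_rightInverse hF p R hR one_pos fun x hx z _ => ?_
  have hx0 := hx.1
  have hz : R z 0 = 0 := hRS z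
  rw [range_modelWithCornersEuclideanHalfSpace] at hx0 ⊢
  simpa [hz] using hx0

end HalfSpace
-- The explicit motion near a definite fold point.
section Fold

open BoundarySpecialGeneric

variable {n m : ℕ}

/-- The Euclidean norm of the coordinates of index at least `m`. -/
noncomputable def foldRadius (m : ℕ) (x : EuclideanSpace ℝ (Fin n)) : ℝ :=
  √(∑ i ∈ {i : Fin n | m ≤ (i : ℕ)}, x i ^ 2)

theorem continuous_foldRadius : Continuous (foldRadius (n := n) m) := by
  unfold foldRadius
  fun_prop

theorem sq_foldRadius (x : EuclideanSpace ℝ (Fin n)) :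
    foldRadius m x ^ 2 = ∑ i ∈ {i : Fin n | m ≤ (i : ℕ)}, x i ^ 2 :=
  Real.sq_sqrt (Finset.sum_nonneg fun _ _ => sq_nonneg _)

theorem abs_le_foldRadius (x : EuclideanSpace ℝ (Fin n)) {i : Fin n} (hi : m ≤ (i : ℕ)) :
    |x i| ≤ foldRadius m x := by
  rw [← Real.sqrt_sq_eq_abs]
  exact Real.sqrt_le_sqrt (Finset.single_le_sum (f := fun i => x i ^ 2)
    (fun _ _ => sq_nonneg _) (by simpa using hi))

/-- The factor that moves the coordinates of index at least `m` to the ball of radius `√t`. -/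
noncomputable def foldScale (m : ℕ) (x : EuclideanSpace ℝ (Fin n)) (t : ℝ) : ℝ :=
  √t / max (√t) (foldRadius m x)

theorem foldScale_nonneg (x : EuclideanSpace ℝ (Fin n)) (t : ℝ) : 0 ≤ foldScale m x t := by
  unfold foldScale
  positivity

theorem foldScale_le_one (x : EuclideanSpace ℝ (Fin n)) (t : ℝ) : foldScale m x t ≤ 1 :=
  div_le_one_of_le₀ (le_max_left _ _) (by positivity)

theorem foldScale_mul_foldRadius_le (x : EuclideanSpace ℝ (Fin n)) (t : ℝ) :
    foldScale m x t * foldRadius m x ≤ √t := by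
  rw [foldScale, div_mul_eq_mul_div]
  refine div_le_of_le_mul₀ (by positivity) (by positivity) ?_
  gcongr
  exact le_max_right _ _

theorem sum_sq_foldScale (x : EuclideanSpace ℝ (Fin n)) (t : ℝ) :
    ∑ i ∈ {i : Fin n | m ≤ (i : ℕ)}, (foldScale m x t * x i) ^ 2 =
      (foldScale m x t * foldRadius m x) ^ 2 := by
  rw [mul_pow, sq_foldRadius, Finset.mul_sum]
  simp only [mul_pow]

theorem foldScale_mul_of_le {x : EuclideanSpace ℝ (Fin n)} {t : ℝ} (ht : foldRadius m x ^ 2 ≤ t)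
    {i : Fin n} (hi : m ≤ (i : ℕ)) : foldScale m x t * x i = x i := by
  have hle : foldRadius m x ≤ √t := Real.le_sqrt_of_sq_le ht
  rw [foldScale, max_eq_left hle]
  rcases eq_or_ne (√t) 0 with h0 | h0
  · have : |x i| ≤ 0 := (abs_le_foldRadius x hi).trans (h0 ▸ hle)
    rw [abs_nonpos_iff.1 this, mul_zero]
  · rw [div_self h0, one_mul]

/-- The factor alone may jump where its denominator vanishes, but it lies in `[0, 1]` and the
coordinate it multiplies tends to `0` there. -/
theorem continuous_foldScale_mul {i : Fin n} (hi : m ≤ (i : ℕ)) :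
    Continuous fun z : EuclideanSpace ℝ (Fin n) × ℝ => foldScale m z.1 z.2 * z.1 i := by
  have hmax : Continuous fun z : EuclideanSpace ℝ (Fin n) × ℝ => max (√z.2) (foldRadius m z.1) :=
    (Real.continuous_sqrt.comp continuous_snd).max (continuous_foldRadius.comp continuous_fst)
  refine continuous_iff_continuousAt.2 fun z => ?_
  by_cases h : max (√z.2) (foldRadius m z.1) = 0
  · have hrad : foldRadius m z.1 = 0 :=
      le_antisymm (h ▸ le_max_right _ _) (Real.sqrt_nonneg _)
    have hzi : z.1 i = 0 := abs_nonpos_iff.1 (hrad ▸ abs_le_foldRadius z.1 hi)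
    unfold ContinuousAt
    beta_reduce
    rw [hzi, mul_zero]
    have hlim : Tendsto (fun z : EuclideanSpace ℝ (Fin n) × ℝ => |z.1 i|) (𝓝 z) (𝓝 0) := by
      have : ContinuousAt (fun z : EuclideanSpace ℝ (Fin n) × ℝ => |z.1 i|) z := by fun_prop
      simpa [ContinuousAt, hzi] using this
    refine squeeze_zero_norm (fun z' => ?_) hlim
    rw [Real.norm_eq_abs, abs_mul, abs_of_nonneg (foldScale_nonneg _ _)]
    exact mul_le_of_le_one_left (abs_nonneg _) (foldScale_le_one _ _)
  · refine ContinuousAt.mul (ContinuousAt.div ?_ hmax.continuousAt h) (by fun_prop)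
    exact (Real.continuous_sqrt.comp continuous_snd).continuousAt

variable (hm : 1 ≤ m) (hmn : m < n)

/-- The point of the fibre of the normal form over `y` to which the point `x` is moved. -/
noncomputable def foldLift (x : EuclideanSpace ℝ (Fin n)) (y : EuclideanSpace ℝ (Fin m)) :
    EuclideanSpace ℝ (Fin n) :=
  WithLp.toLp 2 fun i : Fin n =>
    if h : m ≤ (i : ℕ) then foldScale m x (y ⟨m - 1, by omega⟩) * x i
    else if (i : ℕ) = 0 then y ⟨m - 1, by omega⟩ -
      (foldScale m x (y ⟨m - 1, by omega⟩) * foldRadius m x) ^ 2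
    else y ⟨(i : ℕ) - 1, by omega⟩

theorem foldLift_apply_of_le (x : EuclideanSpace ℝ (Fin n)) (y : EuclideanSpace ℝ (Fin m))
    {i : Fin n} (hi : m ≤ (i : ℕ)) :
    foldLift hm x y i = foldScale m x (y ⟨m - 1, by omega⟩) * x i := by
  simp [foldLift, hi]

theorem continuous_foldLift : Continuous fun z : EuclideanSpace ℝ (Fin n) ×
    EuclideanSpace ℝ (Fin m) => foldLift hm z.1 z.2 := by
  have hlast : Continuous fun z : EuclideanSpace ℝ (Fin n) × EuclideanSpace ℝ (Fin m) =>
      (z.1, z.2 ⟨m - 1, by omega⟩) := by fun_prop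
  have hscale : ∀ i : Fin n, m ≤ (i : ℕ) → Continuous fun z : EuclideanSpace ℝ (Fin n) ×
      EuclideanSpace ℝ (Fin m) => foldScale m z.1 (z.2 ⟨m - 1, by omega⟩) * z.1 i := fun i hi =>
    (continuous_foldScale_mul hi).comp hlast
  refine (PiLp.continuous_toLp 2 _).comp (continuous_pi fun i => ?_)
  by_cases hi : m ≤ (i : ℕ)
  · simpa only [hi, dite_true] using hscale i hi
  · simp only [hi, dite_false]
    split_ifs
    -- Expanding the square into coordinates leaves only the products whose continuity is known.
    · simp only [← sum_sq_foldScale]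
      refine Continuous.sub (by fun_prop) (continuous_finsetSum _ fun j hj => ?_)
      exact (hscale j (by simpa using hj)).pow 2
    · fun_prop

variable [NeZero n]

theorem foldLift_apply_zero (x : EuclideanSpace ℝ (Fin n)) (y : EuclideanSpace ℝ (Fin m)) :
    foldLift hm x y 0 = y ⟨m - 1, by omega⟩ -
      (foldScale m x (y ⟨m - 1, by omega⟩) * foldRadius m x) ^ 2 := by
  have : ¬ m = 0 := by omega
  simp [foldLift, this]

theorem foldLift_apply_of_lt (x : EuclideanSpace ℝ (Fin n)) (y : EuclideanSpace ℝ (Fin m))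
    {i : Fin n} (hi : (i : ℕ) < m) (hi0 : (i : ℕ) ≠ 0) :
    foldLift hm x y i = y ⟨(i : ℕ) - 1, by omega⟩ := by
  have : i ≠ 0 := fun h => hi0 (by simp [h])
  simp [foldLift, this, hi.not_ge]

theorem foldLift_zero_nonneg (x : EuclideanSpace ℝ (Fin n)) {y : EuclideanSpace ℝ (Fin m)}
    (hy : 0 ≤ y ⟨m - 1, by omega⟩) : 0 ≤ foldLift hm x y 0 := by
  rw [foldLift_apply_zero, sub_nonneg]
  calc _ ≤ √(y ⟨m - 1, by omega⟩) ^ 2 :=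
        pow_le_pow_left₀ (mul_nonneg (foldScale_nonneg _ _) (Real.sqrt_nonneg _))
          (foldScale_mul_foldRadius_le _ _) 2
    _ = _ := Real.sq_sqrt hy

theorem foldForm_apply_last (x : EuclideanSpace ℝ (Fin n)) :
    foldForm hmn x ⟨m - 1, by omega⟩ = foldRadius m x ^ 2 + x 0 := by
  have : ¬ m - 1 + 1 < m := by omega
  simp [foldForm, this, sq_foldRadius]

theorem foldForm_apply_pred (x : EuclideanSpace ℝ (Fin n)) {i : Fin n} (hi : (i : ℕ) < m)
    (hi0 : (i : ℕ) ≠ 0) : foldForm hmn x ⟨(i : ℕ) - 1, by omega⟩ = x i := by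
  have h1 : (i : ℕ) - 1 + 1 = i := by omega
  simp [foldForm, h1, hi]

theorem continuous_foldForm : Continuous (foldForm hmn : EuclideanSpace ℝ (Fin n) → _) := by
  refine (PiLp.continuous_toLp 2 _).comp (continuous_pi fun j => ?_)
  split_ifs <;> fun_prop

theorem foldForm_zero : foldForm hmn (0 : EuclideanSpace ℝ (Fin n)) = 0 := by
  ext j
  simp [foldForm]

/-- The coordinate of index `0` is defined as what remains of the last coordinate of `y`, so no sign
condition is needed. -/
theorem foldForm_foldLift (x : EuclideanSpace ℝ (Fin n)) (y : EuclideanSpace ℝ (Fin m)) :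
    foldForm hmn (foldLift hm x y) = y := by
  ext j
  by_cases hj : (j : ℕ) + 1 < m
  · have := foldLift_apply_of_lt hm x y (i := ⟨(j : ℕ) + 1, by omega⟩) hj (by simp)
    simpa [foldForm, hj] using this
  · have hjm : j = ⟨m - 1, by omega⟩ := Fin.ext (by simp; omega)
    rw [hjm, foldForm_apply_last hm, sq_foldRadius, foldLift_apply_zero, ← sum_sq_foldScale,
      Finset.sum_congr rfl fun i hi => by
        rw [foldLift_apply_of_le hm x y (i := i) (by simpa using hi)]]
    ring

/-- On the half-space the last value is at least the squared radius, so the radial clipping does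
nothing. -/
theorem foldLift_foldForm {x : EuclideanSpace ℝ (Fin n)} (hx : 0 ≤ x 0) :
    foldLift hm x (foldForm hmn x) = x := by
  have hle : foldRadius m x ^ 2 ≤ foldForm hmn x ⟨m - 1, by omega⟩ := by
    rw [foldForm_apply_last hm]
    linarith
  ext i
  by_cases hi : m ≤ (i : ℕ)
  · rw [foldLift_apply_of_le hm x _ hi, foldScale_mul_of_le hle hi]
  · by_cases hi0 : (i : ℕ) = 0
    · have : i = 0 := Fin.ext (by simp [hi0])
      rw [this, foldLift_apply_zero, ← sum_sq_foldScale, Finset.sum_congr rfl fun i hi => by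
        rw [foldScale_mul_of_le hle (i := i) (by simpa using hi)], ← sq_foldRadius,
        foldForm_apply_last hm]
      ring
    · rw [foldLift_apply_of_lt hm x _ (by omega) hi0, foldForm_apply_pred hmn x (by omega) hi0]

theorem eq_zero_of_foldForm_eq_zero (hm : 1 ≤ m) (hmn : m < n)
    {x : EuclideanSpace ℝ (Fin n)} (hx : 0 ≤ x 0) (h : foldForm hmn x = 0) : x = 0 := by
  have hlast := foldForm_apply_last hm hmn x
  rw [h, PiLp.zero_apply] at hlast
  have hrad : foldRadius m x = 0 := by nlinarith [sq_nonneg (foldRadius m x)]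
  ext i
  by_cases hi : m ≤ (i : ℕ)
  · exact abs_nonpos_iff.1 (hrad ▸ abs_le_foldRadius x hi)
  · by_cases hi0 : (i : ℕ) = 0
    · have : i = 0 := Fin.ext (by simp [hi0])
      rw [this, PiLp.zero_apply]
      rw [hrad] at hlast
      linarith
    · rw [← foldForm_apply_pred hmn x (by omega) hi0, h]
      rfl

variable {N : Type*} [TopologicalSpace N] [ChartedSpace (EuclideanHalfSpace n) N]
  {F : N → EuclideanSpace ℝ (Fin m)}

/-- The last value of the normal form is a sum of nonnegative terms, so the fibre through the origin
is one point, and the nearby values fill only a half-ball. -/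
theorem isIsolatedTubePoint_of_isBoundaryDefiniteFoldPoint (hm : 1 ≤ m) (hmn : m < n) {p : N}
    (h : IsBoundaryDefiniteFoldPoint hmn F p) : IsIsolatedTubePoint F p := by
  obtain ⟨-, φ, -, ψ, -, hpφ, hφp, hφψ⟩ := h
  let J := 𝓡∂ n
  -- `J.symm` retracts onto the half-space, so `S` is continuous for all `y`; it gives the true lift
  -- once the last coordinate of `y` is nonnegative.
  let S : N × EuclideanSpace ℝ (Fin m) → EuclideanHalfSpace n :=
    fun z => J.symm (foldLift hm (φ z.1).val z.2)
  let G : N → EuclideanSpace ℝ (Fin m) := fun x => foldForm hmn (φ x).val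
  have hGc : ContinuousOn G φ.source :=
    (continuous_foldForm hmn).comp_continuousOn (continuous_subtype_val.comp_continuousOn
      φ.continuousOn)
  have hGp : G p = 0 := by simp only [G, hφp, foldForm_zero]
  have hSself : ∀ x, S (x, G x) = φ x := by
    intro x
    simp only [S, G, foldLift_foldForm hm hmn (φ x).2]
    exact J.left_inv (φ x)
  have hSval : ∀ x, ∀ y : EuclideanSpace ℝ (Fin m), 0 ≤ y ⟨m - 1, by omega⟩ →
      (S (x, y)).val = foldLift hm (φ x).val y := by
    intro x y hy
    refine J.right_inv ?_
    rw [range_modelWithCornersEuclideanHalfSpace]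
    exact foldLift_zero_nonneg hm _ hy
  have hSc : ContinuousOn S (φ.source ×ˢ univ) := by
    refine J.continuous_symm.comp_continuousOn ((continuous_foldLift hm).comp_continuousOn
      (f := fun z : N × EuclideanSpace ℝ (Fin m) => ((φ z.1).val, z.2)) ?_)
    exact (continuous_subtype_val.comp_continuousOn
      (φ.continuousOn.comp continuousOn_fst fun z hz => hz.1)).prodMk continuousOn_snd
  have hΩ : IsOpen ((φ.source ×ˢ univ) ∩ S ⁻¹' φ.target) :=
    hSc.isOpen_inter_preimage (φ.open_source.prod isOpen_univ) φ.open_target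
  obtain ⟨u, v, huo, hvo, hpu, h0v, huv⟩ := isOpen_prod_iff.1 hΩ p 0 ⟨⟨hpφ, trivial⟩, by
    rw [mem_preimage, ← hGp, hSself]
    exact φ.map_source hpφ⟩
  obtain ⟨r, hr, hrv⟩ := Metric.isOpen_iff.1 hvo 0 h0v
  let D : Set (EuclideanSpace ℝ (Fin m)) := {y | 0 ≤ y ⟨m - 1, by omega⟩} ∩ Metric.ball 0 r
  let V : Set N := (φ.source ∩ G ⁻¹' Metric.ball 0 r) ∩ u
  have hST : ∀ x ∈ V, ∀ y ∈ D, S (x, y) ∈ φ.target := fun x hx y hy =>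
    (huv (show (x, y) ∈ u ×ˢ v from ⟨hx.2, hrv hy.2⟩)).2
  have hGT : ∀ x ∈ V, ∀ y ∈ D, G (φ.symm (S (x, y))) = y := by
    intro x hx y hy
    simp only [G]
    rw [φ.right_inv (hST x hx y hy), hSval x y hy.1, foldForm_foldLift]
  have hGψ : ∀ x ∈ φ.source, F x = ψ.symm (G x) := by
    intro x hx
    obtain ⟨h1, h2⟩ := hφψ x hx
    rw [show G x = ψ (F x) from h2.symm, ψ.left_inv h1]
  refine ⟨V, D, 0, G, fun z => φ.symm (S z), ⟨?_, ?_, ?_, ?_, ?_, ?_, ?_, ?_, ?_, ?_, ?_⟩, ?_⟩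
  · exact (hGc.isOpen_inter_preimage φ.open_source Metric.isOpen_ball).inter huo
  · rintro _ rfl
    exact ⟨⟨hpφ, by simp [hGp, hr]⟩, hpu⟩
  · refine Convex.inter ?_ (convex_ball _ _)
    exact convex_halfSpace_ge (f := fun y : EuclideanSpace ℝ (Fin m) => y ⟨m - 1, by omega⟩)
      ⟨fun _ _ => rfl, fun _ _ => rfl⟩ 0
  · exact hGc.mono fun x hx => hx.1.1
  · intro x hx
    refine ⟨?_, hx.1.2⟩
    change 0 ≤ foldForm hmn (φ x).val ⟨m - 1, by omega⟩
    rw [foldForm_apply_last hm]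
    exact add_nonneg (sq_nonneg _) (φ x).2
  · rintro _ rfl
    exact hGp
  · intro x hx x' hx' hxx'
    rw [show G x = ψ (F x) from (hφψ x hx.1.1).2.symm, hxx', (hφψ x' hx'.1.1).2]
  · exact φ.continuousOn_symm.comp (hSc.mono fun z hz => ⟨hz.1.1.1, trivial⟩)
      fun z hz => hST z.1 hz.1 z.2 hz.2
  · exact fun x hx y hy _ => hGT x hx y hy
  · intro x hx x' hx' y hy
    rw [hGψ _ (φ.map_target (hST x hx y hy)), hGψ _ (φ.map_target (hST x' hx' y hy)),
      hGT x hx y hy, hGT x' hx' y hy]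
  · intro x hx
    simp only [hSself]
    exact φ.left_inv hx.1.1
  · intro x hx hxp
    have hGx : G x = 0 := by
      rw [← hGp, show G x = ψ (F x) from (hφψ x hx.1.1).2.symm, hxp, (hφψ p hpφ).2]
    have hφx : φ x = φ p := Subtype.ext (by
      rw [hφp]
      exact eq_zero_of_foldForm_eq_zero hm hmn (φ x).2 hGx)
    exact φ.injOn hx.1.1 hpφ hφx

end Fold

end LocallyInessential

/-! ### The theorem for boundary special generic maps. -/

theorem proposition2p9 {n m : ℕ} [NeZero n] (hm : 1 ≤ m) (hmn : m < n)
    {N : Type*} [TopologicalSpace N] [T2Space N] [CompactSpace N] [ConnectedSpace N]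
    [ChartedSpace (EuclideanHalfSpace n) N] [IsManifold (𝓡∂ n) ∞ N]
    (F : N → EuclideanSpace ℝ (Fin m))
    (hF : BoundarySpecialGeneric.IsBoundarySpecialGenericMap hmn F)
    (x : N) (w : ReebSpace F) :
    Nonempty (FundamentalGroup N x ≃* FundamentalGroup (ReebSpace F) w) := by
  have : LocallyPathConnectedSpace N :=
    ChartedSpace.locallyPathConnectedSpace (EuclideanHalfSpace n) N
  have : Nonempty (Fin m) := ⟨⟨0, hm⟩⟩
  have : NoncompactSpace (EuclideanSpace ℝ (Fin m)) := NormedSpace.noncompactSpace ℝ _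
  have hF1 : ContMDiff (𝓡∂ n) (𝓡 m) 1 F := hF.contMDiff.of_le (by simp)
  refine LocallyInessential.nonempty_fundamentalGroup_mulEquiv_reebSpace hF1.continuous
    (fun p => ?_) x w
  rcases (𝓡∂ n).isInteriorPoint_or_isBoundaryPoint p with hp | hp
  · exact Or.inl (LocallyInessential.hasLift_of_isInteriorPoint hF1 hp (hF.surjective_mfderiv p))
  · by_cases hs : p ∈ BoundarySpecialGeneric.boundarySingularSet (n := n) (m := m) F
    · exact Or.inr (LocallyInessential.isIsolatedTubePoint_of_isBoundaryDefiniteFoldPoint hm hmn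
        (hF.fold p hs))
    · refine Or.inl (LocallyInessential.hasLift_of_map_boundaryTangentSpace hF1 ?_)
      by_contra hne
      exact hs ⟨hp, hne⟩
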